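/- Let $m\ge 1$ and let $L_1,\dots,L_m$ be elements of the Selberg class $\mathcal S$. That is, each $L=L_j$ is given for $\Re s>1$ by an absolutely convergent Dirichlet series $\sum_{n\ge1}a_L(n)n^{-s}$ such that: (i) $a_L(n)\ll_\varepsilon n^{\varepsilon}$ for every $\varepsilon>0$; (ii) for some integer $m_L\ge 0$ the function $(s-1)^{m_L}L(s)$ extends to an entire function of finite order; (iii) there are $\theta\in\mathbb C$ with $|\theta|=1$, real numbers $Q>0$, $\lambda_1,\dots,\lambda_r>0$ and complex $\mu_1,\dots,\mu_r$ with $\Re\mu_i\ge0$ such that $\Lambda(s):=L(s)Q^s\prod_{i=1}^r\Gamma(\lambda_i s+\mu_i)$ satisfies $\Lambda(s)=\theta\,\overline{\Lambda(1-\overline s)}$ (as meromorphic functions); (iv) for $\Re s>1$ one has $\log L(s)=\sum_p\sum_{k\ge1}b_L(p^k)p^{-ks}$, where $b_L(p^k)\ll p^{k\vartheta}$ for some $\vartheta<1/2$. Assume that there are real constants $c^{(k)}_j$ with $c^{(k)}_1>0$ and complex constants $c^{(k,l)}_j$ such that, as $x\to\infty$, $$\sum_{p\le x}|a_{L_k}(p)|^2=\sum_{j=1}^{2m+1}\frac{c^{(k)}_j\,x}{(\log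 x)^j}+O\!\left(\frac{x}{(\log x)^{2m+2}}\right)\qquad(1\le k\le m),$$ $$\sum_{p\le x}a_{L_k}(p)\overline{a_{L_l}(p)}=\sum_{j=2}^{2m+1}\frac{c^{(k,l)}_j\,x}{(\log x)^j}+O\!\left(\frac{x}{(\log x)^{2m+2}}\right)\qquad(1\le k\ne l\le m),$$ the sums being over primes $p$. Let $\sigma_1<\sigma_2<1$ be real, let $D=\{s\in\mathbb C:\sigma_1<\Re s<\sigma_2\}$, and let $U$ be a bounded open set with $\overline U\subset D$ (for instance a bounded simply connected smooth Jordan domain). Let $H_1$ be the closure in $L^2(U)$ of (the restrictions to $U$ of) the functions analytic on $D$, let $(g_1,\dots,g_m)\in H_1^m$ be non-zero, and put $\Delta_j(z)=\iint_U e^{-sz}\,\overline{g_j(s)}\,d\sigma\,dt$ for $z\in\mathbb C$, where $s=\sigma+it$. Then the series over all primes $$\sum_p\left|a_{L_1}(p)\Delta_1(\log p)+\cdots+a_{L_m}(p)\Delta_m(\log p)\right|$$ diverges. -/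

import Mathlib

open Filter Asymptotics MeasureTheory
open scoped ComplexConjugate

/-- An order bound for functions on `ℂ`: `F(s) = O(exp(|s|^A))` as `|s| → ∞`, for some real `A`. -/
def HasFiniteOrder (F : ℂ → ℂ) : Prop :=
  ∃ A : ℝ, F =O[Bornology.cobounded ℂ] fun s : ℂ => Real.exp (‖s‖ ^ A)

/-- `Λ(s) = L(s) Q^s ∏_{j} Γ(λ_j s + μ_j)`. -/
noncomputable def completedFunction (L : ℂ → ℂ) (Q : ℝ) {r : ℕ} (lam : Fin r → ℝ)
    (mu : Fin r → ℂ) (s : ℂ) : ℂ :=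
  L s * (Q : ℂ) ^ s * ∏ j, Complex.Gamma ((lam j : ℂ) * s + mu j)

/-- `IsSelbergClass L a`: the function `L`, with Dirichlet coefficients `a(n)`, `n ≥ 1`, belongs to
the Selberg class. The only possible pole of `L` is `s = 1`; the value of the Lean function `L` at
that one point carries no information and is never used. -/
structure IsSelbergClass (L : ℂ → ℂ) (a : ℕ → ℂ) : Prop where
  /-- `L(s) = ∑ a(n) n^{-s}` for `Re s > 1`. -/
  dirichlet_series : ∀ s : ℂ, 1 < s.re → LSeriesHasSum a s (L s)
  /-- Ramanujan hypothesis. -/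
  ramanujan : ∀ ε : ℝ, 0 < ε → a =O[atTop] fun n : ℕ => (n : ℝ) ^ ε
  /-- `(s - 1)^k L(s)` is entire of finite order for some `k`. -/
  continuation : ∃ (k : ℕ) (F : ℂ → ℂ), Differentiable ℂ F ∧ HasFiniteOrder F ∧
    ∀ s : ℂ, s ≠ 1 → F s = (s - 1) ^ k * L s
  /-- The functional equation `Λ(s) = θ conj (Λ(1 - conj s))`, an identity of meromorphic functions:
  it is stated off the (discrete) set of possible poles of the factors of either side. -/
  functional_equation : ∃ (θ : ℂ) (Q : ℝ) (r : ℕ) (lam : Fin r → ℝ) (mu : Fin r → ℂ),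
    ‖θ‖ = 1 ∧ 0 < Q ∧ (∀ j, 0 < lam j) ∧ (∀ j, 0 ≤ (mu j).re) ∧
    ∀ s : ℂ, s ≠ 0 → s ≠ 1 →
      (∀ j, ∀ n : ℕ, (lam j : ℂ) * s + mu j ≠ -(n : ℂ) ∧
        (lam j : ℂ) * (1 - conj s) + mu j ≠ -(n : ℂ)) →
      completedFunction L Q lam mu s = θ * conj (completedFunction L Q lam mu (1 - conj s))
  /-- Euler product: for `Re s > 1` the (absolutely convergent) double series
  `∑_p ∑_{k ≥ 1} b(p^k) p^{-ks}` is a logarithm of `L(s)`, where `b(p^k) ≪ p^{kϑ}` for some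
  `ϑ < 1/2`. The index `k` below stands for the exponent `k + 1`. -/
  euler_product : ∃ (b : ℕ → ℂ) (ϑ C : ℝ), ϑ < 1 / 2 ∧
    (∀ (p : Nat.Primes) (k : ℕ),
      ‖b ((p : ℕ) ^ (k + 1))‖ ≤ C * ((p : ℕ) : ℝ) ^ (((k + 1 : ℕ) : ℝ) * ϑ)) ∧
    ∀ s : ℂ, 1 < s.re → ∃ ℓ : ℂ, Complex.exp ℓ = L s ∧
      HasSum (fun q : Nat.Primes × ℕ =>
        b ((q.1 : ℕ) ^ (q.2 + 1)) / ((q.1 : ℕ) : ℂ) ^ (((q.2 + 1 : ℕ) : ℂ) * s)) ℓ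

/-- The sum `∑_{p ≤ x} f(p)` over the primes `p ≤ x`. -/
noncomputable def primeSum {M : Type*} [AddCommMonoid M] (f : ℕ → M) (x : ℝ) : M :=
  ∑ p ∈ (Finset.Icc 1 ⌊x⌋₊).filter Nat.Prime, f p

/-- The strengthened Selberg asymptotics for one coefficient sequence, with `2m+1` main terms:
`∑_{p ≤ x} |a(p)|² = ∑_{j=1}^{2m+1} c_j x/(log x)^j + O(x/(log x)^{2m+2})` with `c_1 > 0`. -/
def SelbergDiagonal (m : ℕ) (a : ℕ → ℂ) : Prop :=
  ∃ c : ℕ → ℝ, 0 < c 1 ∧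
    (fun x : ℝ => primeSum (fun p => ‖a p‖ ^ 2) x
      - ∑ j ∈ Finset.Icc 1 (2 * m + 1), c j * x / Real.log x ^ j)
    =O[atTop] fun x : ℝ => x / Real.log x ^ (2 * m + 2)

/-- The strengthened orthogonality relation for two coefficient sequences:
`∑_{p ≤ x} a(p) conj(a'(p)) = ∑_{j=2}^{2m+1} c_j x/(log x)^j + O(x/(log x)^{2m+2})`. -/
def SelbergOrthogonal (m : ℕ) (a a' : ℕ → ℂ) : Prop :=
  ∃ c : ℕ → ℂ,
    (fun x : ℝ => primeSum (fun p => a p * conj (a' p)) x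
      - ∑ j ∈ Finset.Icc 2 (2 * m + 1), c j * (x : ℂ) / (Real.log x : ℂ) ^ j)
    =O[atTop] fun x : ℝ => x / Real.log x ^ (2 * m + 2)

/-- The open vertical strip `D = {s : σ₁ < Re s < σ₂}`. -/
def verticalStrip (σ₁ σ₂ : ℝ) : Set ℂ := {s | σ₁ < s.re ∧ s.re < σ₂}

/-- The elements of `L²(U)` which are restrictions to `U` of functions analytic on `D`. -/
def analyticRestrictions (D U : Set ℂ) : Submodule ℂ (Lp ℂ 2 (volume.restrict U)) where
  carrier := {f | ∃ F : ℂ → ℂ, DifferentiableOn ℂ F D ∧ f =ᵐ[volume.restrict U] F}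
  zero_mem' := ⟨0, differentiableOn_const 0, Lp.coeFn_zero _ _ _⟩
  add_mem' := by
    rintro f g ⟨F, hF, hfF⟩ ⟨G, hG, hgG⟩
    exact ⟨F + G, hF.add hG, (Lp.coeFn_add f g).trans (hfF.add hgG)⟩
  smul_mem' := by
    rintro c f ⟨F, hF, hfF⟩
    exact ⟨c • F, hF.const_smul c, (Lp.coeFn_smul c f).trans (hfF.const_smul c)⟩

/-- The Bergman space `H_1`: the closure of `H(D)` in `L²(U)`. -/
noncomputable def bergmanSpace (D U : Set ℂ) : Submodule ℂ (Lp ℂ 2 (volume.restrict U)) :=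
  (analyticRestrictions D U).topologicalClosure

/-- `Δ(z) = ∬_U e^{-sz} conj(g(s)) dσ dt`. -/
noncomputable def bergmanTransform {U : Set ℂ} (g : Lp ℂ 2 (volume.restrict U)) (z : ℂ) : ℂ :=
  ∫ s in U, Complex.exp (-(s * z)) * conj (g s)

/-!
The divergence has an analytic and an arithmetic half.

Let `Δ_j` be the transform of `g_j`; it is entire of exponential type, and on the positive axis it
is the Laplace transform of a measure carried by a rectangle inside the strip. If `Δ_j(x)` were
`O(e^{-bx})` with `b ≥ σ₂`, its Laplace integral would be holomorphic in the half-plane `Re ζ < b`,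
which contains the rectangle. Off the rectangle that integral is the Cauchy transform of
`conj g_j`, which is holomorphic there and tends to `0` at infinity; so the two glue to an entire
function which is `0` by Liouville's theorem
(`cauchyTransform_eq_zero_of_laplaceTransform_decay`). Cauchy's formula on a slightly larger
rectangle then makes `g_j` orthogonal to all functions analytic on the strip, and since `g_j` lies
in their closure, `g_j = 0` (`eq_zero_of_bergmanTransform_decay`). Hence for some `j` the transform
exceeds `e^{-bx}` at arbitrarily large `x`, where `b = max σ₂ 0 < 1`.

Put `N(x) = max_j |Δ_j(x)|`. Maximising `N` against a weight `e^{-κ|x-y₀|}` yields arbitrarily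
large regular points `y`, at which `N(y) ≥ e^{-by}` and `N(x) ≤ N(y) e^{κ|x-y|}`
(`exists_regular_point`). A two-constants estimate on a half-square shows that near such a point
every `Δ_j` has derivative `O(y N(y))`, so on `[y, y + η/y]` it is constant up to `O(η N(y))`
(`exists_norm_sub_le_of_regular_point`).

The windows `y < log p ≤ y + η/y` are long enough for the prime sums to be evaluated: in units of
`e^y / y²` the sums of `a_k(p) conj(a_l(p))` tend to `c_k η` with `c_k > 0` if `k = l`, and to `0`
otherwise (`tendsto_window_gram`). With `F(p) = ∑_j a_j(p) Δ_j(log p)` it follows that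
`∑ |F(p)|²` over the window is at least a constant times `N(y)² e^y / y²`, once `η` is fixed small
enough. By the Ramanujan bound `|F(p)|` is at most a constant times `e^{εy} N(y)` there, so
`∑ |F(p)|` over the window is at least a constant times `e^{(1-ε)y} N(y) / y² ≥ e^{(1-b-ε)y} / y²`,
which is unbounded (`not_summable_of_large`).
-/

/-! ### Holomorphic parameter integrals -/

open Metric Topology in
/-- Differentiation under the integral sign for integrands that are holomorphic in the parameter:
a bound for the integrand suffices, since Cauchy's estimate turns it into one for the derivative. -/
theorem differentiableAt_integral_of_bounded {α : Type*} [MeasurableSpace α] {μ : Measure α}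
    {k : ℂ → α → ℂ} {bound : α → ℝ} {z₀ : ℂ} {r : ℝ} (hr : 0 < r)
    (hmeas : ∀ z ∈ ball z₀ r, AEStronglyMeasurable (k z) μ)
    (hdiff : ∀ᵐ s ∂μ, DifferentiableOn ℂ (fun z => k z s) (ball z₀ r))
    (hbound : ∀ᵐ s ∂μ, ∀ z ∈ ball z₀ r, ‖k z s‖ ≤ bound s) (hint : Integrable bound μ) :
    DifferentiableAt ℂ (fun z => ∫ s, k z s ∂μ) z₀ := by
  have hz₀ : z₀ ∈ ball z₀ r := mem_ball_self hr
  have hnhds : ball z₀ r ∈ 𝓝 z₀ := ball_mem_nhds z₀ hr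
  have hderiv : ∀ᵐ s ∂μ, ∀ z ∈ ball z₀ (r / 2),
      HasDerivAt (fun z => k z s) (deriv (fun z => k z s) z) z := by
    filter_upwards [hdiff] with s hs z hz
    exact (hs.differentiableAt (isOpen_ball.mem_nhds
      (ball_subset_ball (by linarith) hz))).hasDerivAt
  have hmeas' : AEStronglyMeasurable (fun s => deriv (fun z => k z s) z₀) μ := by
    -- the derivative is the pointwise limit of difference quotients along `z₀ + r / (n + 2)`
    set u : ℕ → ℂ := fun n => z₀ + ((r / (n + 2) : ℝ) : ℂ) with hu
    have hu0 : Tendsto (fun n : ℕ => r / ((n : ℝ) + 2)) atTop (𝓝 0) :=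
      tendsto_const_nhds.div_atTop
        (tendsto_atTop_add_const_right _ _ tendsto_natCast_atTop_atTop)
    have hpos : ∀ n : ℕ, 0 < r / ((n : ℝ) + 2) := fun n => by positivity
    have hlt : ∀ n : ℕ, r / ((n : ℝ) + 2) < r := fun n => by
      apply div_lt_self hr
      have : (0 : ℝ) ≤ n := n.cast_nonneg
      linarith
    have hub : ∀ n, u n ∈ ball z₀ r := fun n => by
      simp only [hu, mem_ball, dist_self_add_left, Complex.norm_real, Real.norm_eq_abs,
        abs_of_pos (hpos n)]
      exact hlt n
    have hut : Tendsto u atTop (𝓝[≠] z₀) := by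
      refine tendsto_nhdsWithin_iff.2 ⟨?_, Eventually.of_forall fun n => ?_⟩
      · have := (Complex.continuous_ofReal.tendsto 0).comp hu0
        simpa [hu, Function.comp_def] using this.const_add z₀
      · have := (hpos n).ne'
        simp only [hu, Set.mem_compl_iff, Set.mem_singleton_iff, add_eq_left]
        exact_mod_cast this
    refine aestronglyMeasurable_of_tendsto_ae (u := atTop)
      (f := fun n s => (u n - z₀)⁻¹ • (k (u n) s - k z₀ s)) ?_ ?_
    · intro n
      exact ((hmeas _ (hub n)).sub (hmeas _ hz₀)).const_smul ((u n - z₀)⁻¹ : ℂ)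
    · filter_upwards [hderiv] with s hs
      have := hasDerivAt_iff_tendsto_slope.1 (hs z₀ (mem_ball_self (half_pos hr)))
      exact this.comp hut
  refine (hasDerivAt_integral_of_dominated_loc_of_deriv_le (μ := μ) (F := k)
    (F' := fun z s => deriv (fun z => k z s) z) (bound := fun s => bound s / (r / 3))
    (ball_mem_nhds z₀ (half_pos hr)) ?_ ?_ hmeas' ?_ (hint.div_const _) hderiv).2.differentiableAt
  · filter_upwards [hnhds] with z hz using hmeas z hz
  · refine hint.mono' (hmeas _ hz₀) ?_
    filter_upwards [hbound] with s hs using hs _ hz₀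
  · filter_upwards [hbound, hdiff] with s hs hd z hz
    have hsub : closedBall z (r / 3) ⊆ ball z₀ r := by
      apply closedBall_subset_ball'
      have := mem_ball.1 hz
      linarith
    refine Complex.norm_deriv_le_of_forall_mem_sphere_norm_le (by positivity) ?_ ?_
    · exact (hd.mono (closure_ball_subset_closedBall.trans hsub)).diffContOnCl
    · exact fun w hw => hs w (hsub (sphere_subset_closedBall hw))

/-! ### Laplace and Cauchy transforms of a complex measure -/

/-- The Laplace transform `z ↦ ∫ e^{-sz} w(s) dμ(s)` of the complex measure `w μ`. -/
noncomputable def laplaceTransform (μ : Measure ℂ) (w : ℂ → ℂ) (z : ℂ) : ℂ :=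
  ∫ s, Complex.exp (-(s * z)) * w s ∂μ

/-- The Cauchy transform `ζ ↦ ∫ w(s) / (s - ζ) dμ(s)` of the complex measure `w μ`. -/
noncomputable def cauchyTransform (μ : Measure ℂ) (w : ℂ → ℂ) (ζ : ℂ) : ℂ :=
  ∫ s, (s - ζ)⁻¹ * w s ∂μ

section Transforms

variable {μ : Measure ℂ} {w : ℂ → ℂ}

theorem norm_exp_neg_mul_le {s z : ℂ} {A : ℝ} (hs : ‖s‖ ≤ A) :
    ‖Complex.exp (-(s * z))‖ ≤ Real.exp (A * ‖z‖) := by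
  rw [Complex.norm_exp]
  apply Real.exp_le_exp.2
  calc (-(s * z)).re ≤ ‖-(s * z)‖ := Complex.re_le_norm _
    _ = ‖s‖ * ‖z‖ := by rw [norm_neg, norm_mul]
    _ ≤ A * ‖z‖ := by gcongr

theorem norm_laplaceTransform_le (hw : Integrable w μ) {A : ℝ} (hA : ∀ᵐ s ∂μ, ‖s‖ ≤ A) (z : ℂ) :
    ‖laplaceTransform μ w z‖ ≤ (∫ s, ‖w s‖ ∂μ) * Real.exp (A * ‖z‖) := by
  rw [mul_comm, ← integral_const_mul]
  refine norm_integral_le_of_norm_le (hw.norm.const_mul _) ?_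
  filter_upwards [hA] with s hs
  rw [norm_mul]
  gcongr
  exact norm_exp_neg_mul_le hs

theorem differentiable_laplaceTransform (hw : Integrable w μ) {A : ℝ}
    (hA : ∀ᵐ s ∂μ, ‖s‖ ≤ A) : Differentiable ℂ (laplaceTransform μ w) := by
  intro z₀
  refine differentiableAt_integral_of_bounded (r := 1)
    (bound := fun s => Real.exp (|A| * (‖z₀‖ + 1)) * ‖w s‖) one_pos ?_ ?_ ?_
    (hw.norm.const_mul _)
  · intro z _
    have : Continuous fun s : ℂ => Complex.exp (-(s * z)) := by fun_prop
    exact this.aestronglyMeasurable.mul hw.1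
  · exact Eventually.of_forall fun s => by fun_prop
  · filter_upwards [hA] with s hs z hz
    rw [norm_mul]
    gcongr
    refine (norm_exp_neg_mul_le (hs.trans (le_abs_self A))).trans ?_
    apply Real.exp_le_exp.2
    have : ‖z‖ ≤ ‖z₀‖ + 1 := by
      have h1 := norm_le_norm_add_norm_sub z₀ z
      have h2 : ‖z₀ - z‖ < 1 := by simpa [dist_eq_norm, norm_sub_rev] using hz
      linarith
    gcongr

theorem differentiableAt_cauchyTransform (hw : Integrable w μ) {K : Set ℂ} (hK : IsClosed K)
    (hsupp : ∀ᵐ s ∂μ, s ∈ K) {ζ : ℂ} (hζ : ζ ∉ K) :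
    DifferentiableAt ℂ (cauchyTransform μ w) ζ := by
  obtain ⟨r, hr, hball⟩ := Metric.isOpen_iff.1 hK.isOpen_compl ζ hζ
  have hfar : ∀ s ∈ K, ∀ z ∈ Metric.ball ζ (r / 2), r / 2 ≤ ‖s - z‖ := by
    intro s hs z hz
    by_contra! hlt
    refine hball (Metric.mem_ball.2 ?_) hs
    have h1 := dist_triangle s z ζ
    rw [dist_eq_norm s z] at h1
    have := Metric.mem_ball.1 hz
    linarith
  refine differentiableAt_integral_of_bounded (r := r / 2)
    (bound := fun s => (r / 2)⁻¹ * ‖w s‖) (by positivity) ?_ ?_ ?_ (hw.norm.const_mul _)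
  · intro z _
    have : Measurable fun s : ℂ => (s - z)⁻¹ := by fun_prop
    exact this.aestronglyMeasurable.mul hw.1
  · filter_upwards [hsupp] with s hs z hz
    have : s - z ≠ 0 := norm_pos_iff.1 ((half_pos hr).trans_le (hfar s hs z hz))
    exact (((differentiableAt_id.const_sub s).inv this).mul_const _).differentiableWithinAt
  · filter_upwards [hsupp] with s hs z hz
    rw [norm_mul, norm_inv]
    gcongr
    exact hfar s hs z hz

theorem tendsto_cauchyTransform_cocompact (hw : Integrable w μ) {A : ℝ}
    (hA : ∀ᵐ s ∂μ, ‖s‖ ≤ A) :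
    Tendsto (cauchyTransform μ w) (cocompact ℂ) (nhds 0) := by
  have hlim : Tendsto (fun ζ : ℂ => (‖ζ‖ - A)⁻¹ * ∫ s, ‖w s‖ ∂μ) (cocompact ℂ) (nhds 0) := by
    rw [← zero_mul (∫ s, ‖w s‖ ∂μ)]
    refine Tendsto.mul_const _ (tendsto_inv_atTop_zero.comp ?_)
    exact tendsto_atTop_add_const_right _ _ (tendsto_norm_cocompact_atTop (E := ℂ))
  refine squeeze_zero_norm' ?_ hlim
  filter_upwards [(tendsto_norm_cocompact_atTop (E := ℂ)).eventually_gt_atTop A] with ζ hζ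
  rw [← integral_const_mul]
  refine norm_integral_le_of_norm_le (hw.norm.const_mul _) ?_
  filter_upwards [hA] with s hs
  rw [norm_mul, norm_inv]
  have : ‖ζ‖ - A ≤ ‖s - ζ‖ := by
    have := norm_sub_norm_le ζ s
    rw [norm_sub_rev]
    linarith
  have : 0 < ‖ζ‖ - A := by linarith
  gcongr

/-- A function of exponential decay on the positive axis has a Laplace integral
`∫_0^∞ f(x) e^{ζx} dx` holomorphic in a left half-plane. -/
theorem differentiableAt_integral_Ioi_mul_exp {f : ℝ → ℂ} (hf : Continuous f) {C b : ℝ}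
    (hb : ∀ x : ℝ, 0 ≤ x → ‖f x‖ ≤ C * Real.exp (-(b * x))) {ζ : ℂ} (hζ : ζ.re < b) :
    DifferentiableAt ℂ (fun z : ℂ => ∫ x in Set.Ioi (0 : ℝ), Complex.exp (z * x) * f x) ζ := by
  have hC : 0 ≤ C := by simpa using (norm_nonneg _).trans (hb 0 le_rfl)
  set r : ℝ := (b - ζ.re) / 2 with hr
  have hr0 : 0 < r := by rw [hr]; linarith
  refine differentiableAt_integral_of_bounded (r := r)
    (bound := fun x => C * Real.exp (-r * x)) hr0 ?_ ?_ ?_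
    ((integrableOn_exp_mul_Ioi (neg_lt_zero.2 hr0) 0).const_mul _)
  · intro z _
    have : Continuous fun x : ℝ => Complex.exp (z * x) * f x := by fun_prop
    exact this.aestronglyMeasurable
  · exact Eventually.of_forall fun s => by fun_prop
  · refine (ae_restrict_mem measurableSet_Ioi).mono fun x (hx : 0 < x) z hz => ?_
    have hre : z.re ≤ ζ.re + r := by
      have h1 := Complex.re_le_norm (z - ζ)
      have h2 : ‖z - ζ‖ < r := by simpa [dist_eq_norm] using hz
      rw [Complex.sub_re] at h1
      linarith
    rw [norm_mul, Complex.norm_exp]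
    have h3 : (z * x).re = z.re * x := by simp
    calc Real.exp (z * x).re * ‖f x‖
        ≤ Real.exp ((ζ.re + r) * x) * (C * Real.exp (-(b * x))) := by
          rw [h3]
          gcongr
          exact hb x hx.le
      _ = C * Real.exp (-r * x) := by
          rw [mul_left_comm, ← Real.exp_add]
          congr 2
          rw [hr]; ring

/-- Left of the support, the Cauchy transform is the Laplace integral of the Laplace transform. -/
theorem integral_Ioi_exp_mul_laplaceTransform [SFinite μ] (hw : Integrable w μ) {α : ℝ}
    (hα : ∀ᵐ s ∂μ, α ≤ s.re) {ζ : ℂ} (hζ : ζ.re < α) :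
    ∫ x in Set.Ioi (0 : ℝ), Complex.exp (ζ * x) * laplaceTransform μ w x
      = cauchyTransform μ w ζ := by
  have hint : Integrable (Function.uncurry fun (x : ℝ) (s : ℂ) =>
      Complex.exp (ζ * x) * (Complex.exp (-(s * x)) * w s))
      ((volume.restrict (Set.Ioi (0 : ℝ))).prod μ) := by
    have hdom : Integrable (fun p : ℝ × ℂ => Real.exp (-(α - ζ.re) * p.1) * ‖w p.2‖)
        ((volume.restrict (Set.Ioi (0 : ℝ))).prod μ) :=
      Integrable.mul_prod (integrableOn_exp_mul_Ioi (by linarith) 0) hw.norm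
    refine hdom.mono' ?_ ?_
    · have h1 : Continuous fun p : ℝ × ℂ => Complex.exp (ζ * p.1) := by fun_prop
      have h2 : Continuous fun p : ℝ × ℂ => Complex.exp (-(p.2 * p.1)) := by fun_prop
      exact h1.aestronglyMeasurable.mul (h2.aestronglyMeasurable.mul hw.1.comp_snd)
    · have hx : ∀ᵐ p ∂((volume.restrict (Set.Ioi (0 : ℝ))).prod μ), p.1 ∈ Set.Ioi (0 : ℝ) :=
        Measure.quasiMeasurePreserving_fst.ae (ae_restrict_mem measurableSet_Ioi)
      have hs : ∀ᵐ p ∂((volume.restrict (Set.Ioi (0 : ℝ))).prod μ), α ≤ p.2.re :=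
        Measure.quasiMeasurePreserving_snd.ae hα
      filter_upwards [hx, hs] with p hp hp'
      simp only [Function.uncurry, norm_mul, ← mul_assoc, Complex.norm_exp, ← Real.exp_add]
      gcongr
      have : (0 : ℝ) < p.1 := hp
      simp only [Complex.mul_re, Complex.neg_re, Complex.ofReal_re, Complex.ofReal_im, mul_zero,
        sub_zero]
      nlinarith
  simp only [laplaceTransform, cauchyTransform, ← integral_const_mul]
  rw [integral_integral_swap hint]
  refine integral_congr_ae ?_
  filter_upwards [hα] with s hs
  simp only [← mul_assoc, integral_mul_const, ← Complex.exp_add]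
  congr 1
  have hre : (ζ - s).re < 0 := by rw [Complex.sub_re]; linarith
  have := integral_exp_mul_complex_Ioi hre 0
  simp only [Complex.ofReal_zero, mul_zero, Complex.exp_zero] at this
  rw [← neg_sub ζ s, inv_neg, ← one_div, ← neg_div, ← this]
  congr 1 with x
  congr 1
  ring

end Transforms

/-! ### Vanishing of the Cauchy transform, and integration over rectangles -/

/-- The closed rectangle `α ≤ Re s ≤ β`, `|Im s| ≤ T`. -/
def closedRect (α β T : ℝ) : Set ℂ := {s | α ≤ s.re ∧ s.re ≤ β ∧ |s.im| ≤ T}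

theorem isClosed_closedRect (α β T : ℝ) : IsClosed (closedRect α β T) :=
  (isClosed_le continuous_const Complex.continuous_re).inter
    ((isClosed_le Complex.continuous_re continuous_const).inter
      (isClosed_le Complex.continuous_im.abs continuous_const))

theorem norm_le_of_mem_closedRect {α β T : ℝ} {s : ℂ} (hs : s ∈ closedRect α β T) :
    ‖s‖ ≤ |α| + |β| + T := by
  obtain ⟨h1, h2, h3⟩ := hs
  refine (Complex.norm_le_abs_re_add_abs_im s).trans (add_le_add ?_ h3)
  exact abs_le.2 ⟨by linarith [neg_abs_le α, abs_nonneg β],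
    by linarith [le_abs_self β, abs_nonneg α]⟩

/-- The part of the half-plane `Re ζ < b` outside a rectangle is connected: it is the union of
convex pieces to the left of, above, below and to the right of the rectangle. -/
theorem isPreconnected_halfPlane_diff_closedRect {α β T b : ℝ} (hβ : β < b) :
    IsPreconnected ({ζ : ℂ | ζ.re < b} \ closedRect α β T) := by
  by_cases hαβ : α ≤ β
  swap
  · have : {ζ : ℂ | ζ.re < b} \ closedRect α β T = {ζ : ℂ | ζ.re < b} := by
      ext ζ
      simp only [closedRect, Set.mem_sdiff, Set.mem_ofPred_eq, and_iff_left_iff_imp]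
      rintro - ⟨h1, h2, -⟩
      exact hαβ (h1.trans h2)
    rw [this]
    exact (convex_halfSpace_re_lt b).isPreconnected
  have hL : IsPreconnected {ζ : ℂ | ζ.re < α} := (convex_halfSpace_re_lt α).isPreconnected
  have hA : IsPreconnected ({ζ : ℂ | ζ.re < b} ∩ {ζ : ℂ | T < ζ.im}) :=
    ((convex_halfSpace_re_lt b).inter (convex_halfSpace_im_gt T)).isPreconnected
  have hB : IsPreconnected ({ζ : ℂ | ζ.re < b} ∩ {ζ : ℂ | ζ.im < -T}) :=
    ((convex_halfSpace_re_lt b).inter (convex_halfSpace_im_lt (-T))).isPreconnected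
  have hR : IsPreconnected ({ζ : ℂ | ζ.re < b} ∩ {ζ : ℂ | β < ζ.re}) :=
    ((convex_halfSpace_re_lt b).inter (convex_halfSpace_re_gt β)).isPreconnected
  have h1 := IsPreconnected.union (⟨α - 1, T + 1⟩ : ℂ) (by simp)
    (by simp only [Set.mem_inter_iff, Set.mem_ofPred_eq]; constructor <;> linarith) hL hA
  have h2 := IsPreconnected.union (⟨α - 1, -T - 1⟩ : ℂ) (Or.inl (by simp))
    (by simp only [Set.mem_inter_iff, Set.mem_ofPred_eq]; constructor <;> linarith) h1 hB
  have h3 := IsPreconnected.union (⟨(β + b) / 2, T + 1⟩ : ℂ)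
    (Or.inl (Or.inr (by
      simp only [Set.mem_inter_iff, Set.mem_ofPred_eq]; constructor <;> linarith)))
    (by simp only [Set.mem_inter_iff, Set.mem_ofPred_eq]; constructor <;> linarith) h2 hR
  convert h3 using 1
  ext ζ
  simp only [closedRect, Set.mem_sdiff, Set.mem_ofPred_eq, Set.mem_union, Set.mem_inter_iff, abs_le]
  constructor
  · rintro ⟨h, hn⟩
    by_contra! hcon
    obtain ⟨⟨⟨c1, c2⟩, c3⟩, c4⟩ := hcon
    exact hn ⟨c1, c4 h, c3 h, c2 h⟩
  · rintro (((h | ⟨h, h'⟩) | ⟨h, h'⟩) | ⟨h, h'⟩)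
    · exact ⟨by linarith, fun hh => by linarith [hh.1]⟩
    · exact ⟨h, fun hh => by linarith [hh.2.2.2]⟩
    · exact ⟨h, fun hh => by linarith [hh.2.2.1]⟩
    · exact ⟨h, fun hh => by linarith [hh.2.1]⟩

/-- If the Laplace transform of a measure carried by a rectangle decays faster than `e^{-βx}`,
where `β` is the right-hand edge, then the Cauchy transform of the measure vanishes off the
rectangle: it agrees with a Laplace integral holomorphic across the rectangle, so the two glue to
an entire function tending to `0` at infinity. -/
theorem cauchyTransform_eq_zero_of_laplaceTransform_decay {μ : Measure ℂ} [SFinite μ] {w : ℂ → ℂ}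
    (hw : Integrable w μ) {α β T b C : ℝ} (hβ : β < b)
    (hsupp : ∀ᵐ s ∂μ, s ∈ closedRect α β T)
    (hdecay : ∀ x : ℝ, 0 ≤ x → ‖laplaceTransform μ w x‖ ≤ C * Real.exp (-(b * x)))
    {ζ : ℂ} (hζ : ζ ∉ closedRect α β T) : cauchyTransform μ w ζ = 0 := by
  have hA : ∀ᵐ s ∂μ, ‖s‖ ≤ |α| + |β| + T := hsupp.mono fun s hs => norm_le_of_mem_closedRect hs
  have hK := isClosed_closedRect α β T
  set H : ℂ → ℂ := fun z =>
    ∫ x in Set.Ioi (0 : ℝ), Complex.exp (z * x) * laplaceTransform μ w x with hH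
  have hcont : Continuous fun x : ℝ => laplaceTransform μ w x :=
    (differentiable_laplaceTransform hw hA).continuous.comp Complex.continuous_ofReal
  have hHd : ∀ z : ℂ, z.re < b → DifferentiableAt ℂ H z := fun z hz =>
    differentiableAt_integral_Ioi_mul_exp hcont hdecay hz
  have hopen : IsOpen ({z : ℂ | z.re < b} \ closedRect α β T) :=
    (isOpen_lt Complex.continuous_re continuous_const).sdiff hK
  have hEq : Set.EqOn H (cauchyTransform μ w) ({z : ℂ | z.re < b} \ closedRect α β T) := by
    set z₀ : ℂ := ((min α b - 1 : ℝ) : ℂ) with hz₀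
    have hz₀re : z₀.re = min α b - 1 := by simp [hz₀]
    have hα : z₀.re < α := by linarith [min_le_left α b]
    refine AnalyticOnNhd.eqOn_of_preconnected_of_eventuallyEq
      (DifferentiableOn.analyticOnNhd
        (fun z hz => (hHd z hz.1).differentiableWithinAt) hopen)
      (DifferentiableOn.analyticOnNhd
        (fun z hz => (differentiableAt_cauchyTransform hw hK hsupp hz.2).differentiableWithinAt)
        hopen)
      (isPreconnected_halfPlane_diff_closedRect hβ) (z₀ := z₀) ?_ ?_
    · exact ⟨by simp only [Set.mem_ofPred_eq]; linarith [min_le_right α b],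
        fun h => by linarith [h.1]⟩
    · filter_upwards [(isOpen_lt Complex.continuous_re continuous_const).mem_nhds hα] with z hz
      exact integral_Ioi_exp_mul_laplaceTransform hw (hsupp.mono fun s hs => hs.1) hz
  -- the entire function obtained by gluing
  set c : ℝ := (β + b) / 2 with hc
  set E : ℂ → ℂ := fun z => if z.re < c then H z else cauchyTransform μ w z with hE
  have hEoff : ∀ z, z ∉ closedRect α β T → E z = cauchyTransform μ w z := by
    intro z hz
    by_cases h : z.re < c
    · simp only [hE, h, if_true]
      exact hEq ⟨by simp only [Set.mem_ofPred_eq]; linarith, hz⟩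
    · simp [hE, h]
  have hEd : Differentiable ℂ E := by
    intro z
    by_cases h : z.re < c
    · refine (hHd z (by linarith)).congr_of_eventuallyEq ?_
      filter_upwards [(isOpen_lt Complex.continuous_re continuous_const).mem_nhds h] with y hy
      have : y.re < c := hy
      simp [hE, this]
    · have hz : z ∉ closedRect α β T := fun hh => by linarith [hh.2.1]
      refine (differentiableAt_cauchyTransform hw hK hsupp hz).congr_of_eventuallyEq ?_
      filter_upwards [hK.isOpen_compl.mem_nhds hz] with y hy using hEoff y hy
  have hlim : Tendsto E (cocompact ℂ) (nhds 0) := by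
    refine (tendsto_cauchyTransform_cocompact hw hA).congr' ?_
    filter_upwards [(tendsto_norm_cocompact_atTop (E := ℂ)).eventually_gt_atTop
      (|α| + |β| + T)] with y hy
    exact (hEoff y fun h => absurd (norm_le_of_mem_closedRect h) (not_le.2 hy)).symm
  rw [← hEoff ζ hζ]
  exact hEd.apply_eq_of_tendsto_cocompact ζ hlim

/-- The integral over the boundary of the rectangle with opposite corners `z` and `w`,
counterclockwise when `z` is the lower left corner. -/
noncomputable def rectIntegral (f : ℂ → ℂ) (z w : ℂ) : ℂ :=
  (∫ x : ℝ in z.re..w.re, f (x + z.im * Complex.I))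
    - (∫ x : ℝ in z.re..w.re, f (x + w.im * Complex.I))
    + Complex.I • (∫ y : ℝ in z.im..w.im, f (w.re + y * Complex.I))
    - Complex.I • (∫ y : ℝ in z.im..w.im, f (z.re + y * Complex.I))

theorem integral_inv_horizontal {a b c : ℝ} (hc : c ≠ 0) :
    ∫ x in a..b, ((x : ℂ) + c * Complex.I)⁻¹
      = Complex.log (b + c * Complex.I) - Complex.log (a + c * Complex.I) := by
  have hne : ∀ x : ℝ, ((x : ℂ) + c * Complex.I) ∈ Complex.slitPlane := fun x => by
    rw [Complex.mem_slitPlane_iff]; right; simpa using hc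
  refine intervalIntegral.integral_eq_sub_of_hasDerivAt
    (f := fun x : ℝ => Complex.log (x + c * Complex.I)) (fun x _ => ?_) ?_
  · have h := (((hasDerivAt_id (x : ℂ)).add_const (c * Complex.I)).clog (hne x)).comp_ofReal
    simpa using h
  · refine (ContinuousOn.inv₀ (by fun_prop) fun x _ => ?_).intervalIntegrable
    exact Complex.slitPlane_ne_zero (hne x)

theorem integral_inv_vertical {a b c : ℝ} (hc : 0 < c) :
    Complex.I • ∫ y in a..b, ((c : ℂ) + y * Complex.I)⁻¹
      = Complex.log (c + b * Complex.I) - Complex.log (c + a * Complex.I) := by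
  have hne : ∀ x : ℝ, ((c : ℂ) + x * Complex.I) ∈ Complex.slitPlane := fun x => by
    rw [Complex.mem_slitPlane_iff]; left; simpa using hc
  rw [← intervalIntegral.integral_smul]
  refine intervalIntegral.integral_eq_sub_of_hasDerivAt
    (f := fun y : ℝ => Complex.log (c + y * Complex.I)) (fun x _ => ?_) ?_
  · have h := ((((hasDerivAt_id (x : ℂ)).mul_const Complex.I).const_add (c : ℂ)).clog
      (hne x)).comp_ofReal
    simpa [div_eq_mul_inv] using h
  · have h1 : Continuous fun y : ℝ => (c : ℂ) + y * Complex.I := by fun_prop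
    have h2 : Continuous fun y : ℝ => Complex.I • ((c : ℂ) + y * Complex.I)⁻¹ :=
      (h1.inv₀ fun x => Complex.slitPlane_ne_zero (hne x)).const_smul Complex.I
    exact h2.intervalIntegrable _ _

theorem Complex.log_sub_log_neg_of_im_pos {z : ℂ} (hz : 0 < z.im) :
    Complex.log z - Complex.log (-z) = Real.pi * Complex.I := by
  rw [Complex.log, Complex.log, norm_neg, Complex.arg_neg_eq_arg_sub_pi_of_im_pos hz]
  push_cast
  ring

/-- The winding number of the boundary of a rectangle around an interior point is `1`. -/
theorem rectIntegral_inv_sub {z w s : ℂ} (h1 : z.re < s.re) (h2 : s.re < w.re)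
    (h3 : z.im < s.im) (h4 : s.im < w.im) :
    rectIntegral (fun ζ => (ζ - s)⁻¹) z w = 2 * Real.pi * Complex.I := by
  have hH : ∀ c : ℝ, c - s.im ≠ 0 → ∫ x : ℝ in z.re..w.re, ((x : ℂ) + c * Complex.I - s)⁻¹
      = Complex.log ((w.re - s.re : ℝ) + (c - s.im : ℝ) * Complex.I)
        - Complex.log ((z.re - s.re : ℝ) + (c - s.im : ℝ) * Complex.I) := by
    intro c hc
    rw [← integral_inv_horizontal hc, ← intervalIntegral.integral_comp_sub_right
      (fun x : ℝ => ((x : ℂ) + (c - s.im : ℝ) * Complex.I)⁻¹)]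
    refine intervalIntegral.integral_congr fun x _ => ?_
    congr 1
    apply Complex.ext <;> simp
  have hR : Complex.I • ∫ y : ℝ in z.im..w.im, ((w.re : ℂ) + y * Complex.I - s)⁻¹
      = Complex.log ((w.re - s.re : ℝ) + (w.im - s.im : ℝ) * Complex.I)
        - Complex.log ((w.re - s.re : ℝ) + (z.im - s.im : ℝ) * Complex.I) := by
    rw [← integral_inv_vertical (by linarith : 0 < w.re - s.re),
      ← intervalIntegral.integral_comp_sub_right
      (fun y : ℝ => (((w.re - s.re : ℝ) : ℂ) + y * Complex.I)⁻¹)]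
    congr 1
    refine intervalIntegral.integral_congr fun x _ => ?_
    congr 1
    apply Complex.ext <;> simp
  -- on the left side the logarithm is taken of the negative, to stay off its branch cut
  have hL : Complex.I • ∫ y : ℝ in z.im..w.im, ((z.re : ℂ) + y * Complex.I - s)⁻¹
      = Complex.log (-((z.re - s.re : ℝ) + (w.im - s.im : ℝ) * Complex.I))
        - Complex.log (-((z.re - s.re : ℝ) + (z.im - s.im : ℝ) * Complex.I)) := by
    have e : ∀ u : ℝ, -(((z.re - s.re : ℝ) : ℂ) + (u - s.im : ℝ) * Complex.I)
        = ((s.re - z.re : ℝ) : ℂ) + (s.im - u : ℝ) * Complex.I := fun u => by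
      push_cast; ring
    rw [e, e]
    have := integral_inv_vertical (a := s.im - w.im) (b := s.im - z.im)
      (by linarith : 0 < s.re - z.re)
    rw [← neg_sub, ← this, ← intervalIntegral.integral_comp_sub_left
      (fun y : ℝ => (((s.re - z.re : ℝ) : ℂ) + y * Complex.I)⁻¹), ← smul_neg,
      ← intervalIntegral.integral_neg]
    congr 1
    refine intervalIntegral.integral_congr fun x _ => ?_
    rw [← inv_neg]
    congr 1
    apply Complex.ext <;> simp
  rw [rectIntegral, hH _ (by linarith), hH _ (by linarith), hR, hL]
  have e1 := Complex.log_sub_log_neg_of_im_pos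
    (z := ((z.re - s.re : ℝ) : ℂ) + (w.im - s.im : ℝ) * Complex.I) (by simp; linarith)
  have e2 := Complex.log_sub_log_neg_of_im_pos
    (z := -(((z.re - s.re : ℝ) : ℂ) + (z.im - s.im : ℝ) * Complex.I)) (by simp; linarith)
  rw [neg_neg] at e2
  linear_combination e1 + e2

theorem integral_sub_inv_mul_eq_dslope {F : ℂ → ℂ} {D : Set ℂ} {s : ℂ} (hD : D ∈ nhds s)
    (hF : DifferentiableOn ℂ F D) {γ : ℝ → ℂ} (hγ : Continuous γ) {a b : ℝ}
    (hmem : ∀ t ∈ Set.uIcc a b, γ t ∈ D) (hne : ∀ t ∈ Set.uIcc a b, γ t ≠ s) :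
    ∫ t in a..b, (γ t - s)⁻¹ * F (γ t)
      = (∫ t in a..b, dslope F s (γ t)) + (∫ t in a..b, (γ t - s)⁻¹) * F s := by
  rw [← intervalIntegral.integral_mul_const, ← intervalIntegral.integral_add]
  · refine intervalIntegral.integral_congr fun t ht => ?_
    simp only [dslope_of_ne F (hne t ht), slope_def_field]
    ring
  · refine ContinuousOn.intervalIntegrable ?_
    exact ((Complex.differentiableOn_dslope hD).2 hF).continuousOn.comp hγ.continuousOn hmem
  · refine ContinuousOn.intervalIntegrable (ContinuousOn.mul (ContinuousOn.inv₀ ?_ ?_) ?_)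
    · fun_prop
    · exact fun t ht => sub_ne_zero.2 (hne t ht)
    · fun_prop

/-- Cauchy's integral formula for a rectangle. -/
theorem rectIntegral_sub_inv_mul {z w s : ℂ} (h1 : z.re < s.re) (h2 : s.re < w.re)
    (h3 : z.im < s.im) (h4 : s.im < w.im) {F : ℂ → ℂ} {D : Set ℂ} (hD : IsOpen D)
    (hF : DifferentiableOn ℂ F D) (hsub : Set.uIcc z.re w.re ×ℂ Set.uIcc z.im w.im ⊆ D) :
    rectIntegral (fun ζ => (ζ - s)⁻¹ * F ζ) z w = 2 * Real.pi * Complex.I * F s := by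
  have hzw : z.re ≤ w.re := by linarith
  have hzw' : z.im ≤ w.im := by linarith
  have hsD : D ∈ nhds s := hD.mem_nhds (hsub (by
    rw [Complex.mem_reProdIm, Set.uIcc_of_le hzw, Set.uIcc_of_le hzw']
    exact ⟨⟨h1.le, h2.le⟩, ⟨h3.le, h4.le⟩⟩))
  have hzero : rectIntegral (dslope F s) z w = 0 :=
    Complex.integral_boundary_rect_eq_zero_of_differentiableOn _ z w
      (((Complex.differentiableOn_dslope hsD).2 hF).mono hsub)
  have hwind := rectIntegral_inv_sub h1 h2 h3 h4
  have hH : ∀ c : ℝ, c ∈ Set.uIcc z.im w.im → c ≠ s.im →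
      ∫ x : ℝ in z.re..w.re, ((x : ℂ) + c * Complex.I - s)⁻¹ * F (x + c * Complex.I)
        = (∫ x : ℝ in z.re..w.re, dslope F s (x + c * Complex.I))
          + (∫ x : ℝ in z.re..w.re, ((x : ℂ) + c * Complex.I - s)⁻¹) * F s := by
    intro c hc hcs
    refine integral_sub_inv_mul_eq_dslope hsD hF (γ := fun x : ℝ => (x : ℂ) + c * Complex.I)
      (by fun_prop) (fun t ht => hsub ?_) (fun t ht h => hcs ?_)
    · rw [Complex.mem_reProdIm]; simpa using ⟨ht, hc⟩
    · simpa using congrArg Complex.im h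
  have hV : ∀ c : ℝ, c ∈ Set.uIcc z.re w.re → c ≠ s.re →
      ∫ y : ℝ in z.im..w.im, ((c : ℂ) + y * Complex.I - s)⁻¹ * F (c + y * Complex.I)
        = (∫ y : ℝ in z.im..w.im, dslope F s (c + y * Complex.I))
          + (∫ y : ℝ in z.im..w.im, ((c : ℂ) + y * Complex.I - s)⁻¹) * F s := by
    intro c hc hcs
    refine integral_sub_inv_mul_eq_dslope hsD hF (γ := fun y : ℝ => (c : ℂ) + y * Complex.I)
      (by fun_prop) (fun t ht => hsub ?_) (fun t ht h => hcs ?_)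
    · rw [Complex.mem_reProdIm]; simpa using ⟨hc, ht⟩
    · simpa using congrArg Complex.re h
  rw [rectIntegral] at hzero hwind ⊢
  rw [hH _ Set.left_mem_uIcc h3.ne, hH _ Set.right_mem_uIcc h4.ne',
    hV _ Set.left_mem_uIcc h1.ne, hV _ Set.right_mem_uIcc h2.ne', ← hwind]
  simp only [smul_eq_mul] at hzero ⊢
  linear_combination hzero

/-- Fubini on one arc: if the Cauchy transform vanishes along the arc `γ`, then the integral of
`w` against any Cauchy integral over `γ` vanishes. -/
theorem integral_mul_cauchyIntegral_eq_zero {μ : Measure ℂ} [SFinite μ] {w : ℂ → ℂ}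
    (hw : Integrable w μ) {F : ℂ → ℂ} {γ : ℝ → ℂ} (hγ : Continuous γ) {a b d : ℝ} (hab : a ≤ b)
    (hF : ContinuousOn (fun t => F (γ t)) (Set.uIcc a b)) (hd : 0 < d)
    (hfar : ∀ᵐ s ∂μ, ∀ t ∈ Set.uIcc a b, d ≤ ‖γ t - s‖)
    (hzero : ∀ t ∈ Set.uIcc a b, cauchyTransform μ w (γ t) = 0) :
    Integrable (fun s => (∫ t in a..b, (γ t - s)⁻¹ * F (γ t)) * w s) μ ∧
      ∫ s, (∫ t in a..b, (γ t - s)⁻¹ * F (γ t)) * w s ∂μ = 0 := by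
  have hsub : Set.Ioc a b ⊆ Set.uIcc a b := by
    rw [Set.uIcc_of_le hab]; exact Set.Ioc_subset_Icc_self
  set ν : Measure ℝ := volume.restrict (Set.Ioc a b) with hν
  have hFint : Integrable (fun t => F (γ t)) ν :=
    (hF.integrableOn_compact isCompact_uIcc).mono_set hsub
  have hint : Integrable (fun p : ℂ × ℝ => (γ p.2 - p.1)⁻¹ * F (γ p.2) * w p.1) (μ.prod ν) := by
    have hdom : Integrable (fun p : ℂ × ℝ => d⁻¹ * (‖w p.1‖ * ‖F (γ p.2)‖)) (μ.prod ν) :=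
      (hw.norm.mul_prod hFint.norm).const_mul _
    refine hdom.mono' ?_ ?_
    · have h1 : Measurable fun p : ℂ × ℝ => (γ p.2 - p.1)⁻¹ := by fun_prop
      exact (h1.aestronglyMeasurable.mul hFint.1.comp_snd).mul hw.1.comp_fst
    · have ht : ∀ᵐ p ∂(μ.prod ν), p.2 ∈ Set.Ioc a b :=
        Measure.quasiMeasurePreserving_snd.ae (ae_restrict_mem measurableSet_Ioc)
      have hs := (Measure.quasiMeasurePreserving_fst (μ := μ) (ν := ν)).ae hfar
      filter_upwards [ht, hs] with p hp hp'
      rw [norm_mul, norm_mul, norm_inv, mul_assoc, mul_comm ‖F _‖]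
      gcongr
      exact hp' _ (hsub hp)
  have hinner : ∀ s, (∫ t in a..b, (γ t - s)⁻¹ * F (γ t)) * w s
      = ∫ t, (γ t - s)⁻¹ * F (γ t) * w s ∂ν := fun s => by
    rw [intervalIntegral.integral_of_le hab, ← integral_mul_const]
  simp only [hinner]
  refine ⟨hint.integral_prod_left, ?_⟩
  rw [integral_integral_swap hint]
  refine integral_eq_zero_of_ae ?_
  filter_upwards [ae_restrict_mem measurableSet_Ioc] with t ht
  have e : ∀ s, (γ t - s)⁻¹ * F (γ t) * w s = -F (γ t) * ((s - γ t)⁻¹ * w s) := fun s => by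
    rw [← neg_sub s, inv_neg]; ring
  simp only [e, integral_const_mul]
  have := hzero t (hsub ht)
  rw [cauchyTransform] at this
  simp [this]

/-- A complex measure carried by a rectangle whose Cauchy transform vanishes off the rectangle
annihilates every function holomorphic near a larger rectangle. -/
theorem integral_holomorphic_mul_eq_zero {μ : Measure ℂ} [SFinite μ] {w : ℂ → ℂ}
    (hw : Integrable w μ) {α β T α' β' : ℝ} (hα : α' < α) (hβ : β < β')
    (hsupp : ∀ᵐ s ∂μ, s ∈ closedRect α β T)
    (hzero : ∀ ζ, ζ ∉ closedRect α β T → cauchyTransform μ w ζ = 0)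
    {F : ℂ → ℂ} {D : Set ℂ} (hD : IsOpen D) (hF : DifferentiableOn ℂ F D)
    (hsub : {s : ℂ | α' ≤ s.re ∧ s.re ≤ β'} ⊆ D) : ∫ s, F s * w s ∂μ = 0 := by
  by_cases hne : α ≤ β ∧ 0 ≤ T
  swap
  · have : ∀ᵐ s ∂μ, F s * w s = 0 := hsupp.mono fun s hs =>
      absurd ⟨hs.1.trans hs.2.1, (abs_nonneg _).trans hs.2.2⟩ hne
    exact integral_eq_zero_of_ae this
  obtain ⟨hαβ, hT⟩ := hne
  set z : ℂ := ⟨α', -(T + 1)⟩ with hz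
  set v : ℂ := ⟨β', T + 1⟩ with hv
  have hre : z.re ≤ v.re := by simp only [hz, hv]; linarith
  have him : z.im ≤ v.im := by simp only [hz, hv]; linarith
  have hrect : Set.uIcc z.re v.re ×ℂ Set.uIcc z.im v.im ⊆ D := by
    intro s hs
    rw [Complex.mem_reProdIm, Set.uIcc_of_le hre] at hs
    exact hsub hs.1
  have hFc : ContinuousOn F D := hF.continuousOn
  have hH : ∀ c : ℝ, c ∈ Set.uIcc z.im v.im → |c| = T + 1 →
      Integrable (fun s => (∫ x : ℝ in z.re..v.re,
        ((x : ℂ) + c * Complex.I - s)⁻¹ * F (x + c * Complex.I)) * w s) μ ∧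
      ∫ s, (∫ x : ℝ in z.re..v.re,
        ((x : ℂ) + c * Complex.I - s)⁻¹ * F (x + c * Complex.I)) * w s ∂μ = 0 := by
    intro c hc hcT
    refine integral_mul_cauchyIntegral_eq_zero hw (F := F)
      (γ := fun x : ℝ => (x : ℂ) + c * Complex.I) (by fun_prop) hre ?_ one_pos ?_ ?_
    · refine hFc.comp (by fun_prop) fun x hx => hrect ?_
      rw [Complex.mem_reProdIm]; simpa using ⟨hx, hc⟩
    · filter_upwards [hsupp] with s hs x _
      have h1 := Complex.abs_im_le_norm ((x : ℂ) + c * Complex.I - s)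
      have h2 : ((x : ℂ) + c * Complex.I - s).im = c - s.im := by simp
      have h3 := abs_sub_abs_le_abs_sub c s.im
      rw [h2] at h1
      linarith [hs.2.2]
    · refine fun x _ => hzero _ fun h => ?_
      have := h.2.2
      simp only [Complex.add_im, Complex.ofReal_im, Complex.mul_im, Complex.ofReal_re,
        Complex.I_im, mul_one, Complex.I_re, mul_zero, add_zero, zero_add] at this
      linarith
  have hV : ∀ c : ℝ, c ∈ Set.uIcc z.re v.re → ∀ d, 0 < d → (c ≤ α - d ∨ β + d ≤ c) →
      Integrable (fun s => (∫ y : ℝ in z.im..v.im,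
        ((c : ℂ) + y * Complex.I - s)⁻¹ * F (c + y * Complex.I)) * w s) μ ∧
      ∫ s, (∫ y : ℝ in z.im..v.im,
        ((c : ℂ) + y * Complex.I - s)⁻¹ * F (c + y * Complex.I)) * w s ∂μ = 0 := by
    intro c hc d hd hcd
    refine integral_mul_cauchyIntegral_eq_zero hw (F := F)
      (γ := fun y : ℝ => (c : ℂ) + y * Complex.I) (by fun_prop) him ?_ hd ?_ ?_
    · refine hFc.comp (by fun_prop) fun y hy => hrect ?_
      rw [Complex.mem_reProdIm]; simpa using ⟨hc, hy⟩
    · filter_upwards [hsupp] with s hs y _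
      have h1 := Complex.abs_re_le_norm ((c : ℂ) + y * Complex.I - s)
      have h2 : ((c : ℂ) + y * Complex.I - s).re = c - s.re := by simp
      rw [h2] at h1
      rcases hcd with h | h
      · linarith [neg_le_abs (c - s.re), hs.1]
      · linarith [le_abs_self (c - s.re), hs.2.1]
    · refine fun y _ => hzero _ fun h => ?_
      have h1 := h.1
      have h2 := h.2.1
      simp only [Complex.add_re, Complex.ofReal_re, Complex.mul_re, Complex.ofReal_im,
        Complex.I_re, mul_zero, Complex.I_im, mul_one, add_zero, sub_self] at h1 h2
      rcases hcd with h | h <;> linarith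
  have h₁ := hH z.im Set.left_mem_uIcc
    (by simp only [hz, abs_neg]; exact abs_of_nonneg (by linarith))
  have h₂ := hH v.im Set.right_mem_uIcc (abs_of_nonneg (by simp only [hv]; linarith))
  have h₃ := hV v.re Set.right_mem_uIcc (β' - β) (by linarith)
    (Or.inr (by simp only [hv]; linarith))
  have h₄ := hV z.re Set.left_mem_uIcc (α - α') (by linarith)
    (Or.inl (by simp only [hz]; linarith))
  have hcauchy : ∀ᵐ s ∂μ, F s * w s = (2 * Real.pi * Complex.I)⁻¹ *
      ((∫ x : ℝ in z.re..v.re,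
          ((x : ℂ) + z.im * Complex.I - s)⁻¹ * F (x + z.im * Complex.I)) * w s
        - (∫ x : ℝ in z.re..v.re,
          ((x : ℂ) + v.im * Complex.I - s)⁻¹ * F (x + v.im * Complex.I)) * w s
        + Complex.I * ((∫ y : ℝ in z.im..v.im,
          ((v.re : ℂ) + y * Complex.I - s)⁻¹ * F (v.re + y * Complex.I)) * w s)
        - Complex.I * ((∫ y : ℝ in z.im..v.im,
          ((z.re : ℂ) + y * Complex.I - s)⁻¹ * F (z.re + y * Complex.I)) * w s)) := by
    filter_upwards [hsupp] with s hs
    have him' := abs_le.1 hs.2.2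
    have := rectIntegral_sub_inv_mul (z := z) (w := v) (s := s) (by simp only [hz]; linarith [hs.1])
      (by simp only [hv]; linarith [hs.2.1]) (by simp only [hz]; linarith [him'.1])
      (by simp only [hv]; linarith [him'.2]) hD hF hrect
    rw [rectIntegral] at this
    simp only [smul_eq_mul] at this
    have h2 : (2 * Real.pi * Complex.I : ℂ) ≠ 0 := Complex.two_pi_I_ne_zero
    rw [eq_inv_mul_iff_mul_eq₀ h2]
    linear_combination (-w s) * this
  have hlin : ∀ f₁ f₂ f₃ f₄ : ℂ → ℂ, Integrable f₁ μ ∧ ∫ s, f₁ s ∂μ = 0 →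
      Integrable f₂ μ ∧ ∫ s, f₂ s ∂μ = 0 → Integrable f₃ μ ∧ ∫ s, f₃ s ∂μ = 0 →
      Integrable f₄ μ ∧ ∫ s, f₄ s ∂μ = 0 →
      ∫ s, (2 * Real.pi * Complex.I)⁻¹ *
        (f₁ s - f₂ s + Complex.I * f₃ s - Complex.I * f₄ s) ∂μ = 0 := by
    rintro f₁ f₂ f₃ f₄ ⟨i1, e1⟩ ⟨i2, e2⟩ ⟨i3, e3⟩ ⟨i4, e4⟩
    rw [integral_const_mul, integral_sub (f := fun s => f₁ s - f₂ s + Complex.I * f₃ s)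
      ((i1.sub i2).add (i3.const_mul _)) (i4.const_mul _),
      integral_add (f := fun s => f₁ s - f₂ s) (i1.sub i2) (i3.const_mul _), integral_sub i1 i2,
      integral_const_mul, integral_const_mul, e1, e2, e3, e4]
    simp
  rw [integral_congr_ae hcauchy]
  exact hlin _ _ _ _ h₁ h₂ h₃ h₄

/-! ### The transform on the Bergman space -/

/-- A bounded set with closure in an open vertical strip lies in a rectangle inside the strip. -/
theorem exists_subset_closedRect {σ₁ σ₂ : ℝ} (hσ : σ₁ < σ₂) {U : Set ℂ}
    (hUb : Bornology.IsBounded U) (hUD : closure U ⊆ verticalStrip σ₁ σ₂) :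
    ∃ α β T : ℝ, σ₁ < α ∧ β < σ₂ ∧ U ⊆ closedRect α β T := by
  rcases U.eq_empty_or_nonempty with rfl | hne
  · exact ⟨(σ₁ + σ₂) / 2, (σ₁ + σ₂) / 2, 0, by linarith, by linarith, Set.empty_subset _⟩
  obtain ⟨x, hx, hmin⟩ := hUb.isCompact_closure.exists_isMinOn hne.closure
    Complex.continuous_re.continuousOn
  obtain ⟨y, hy, hmax⟩ := hUb.isCompact_closure.exists_isMaxOn hne.closure
    Complex.continuous_re.continuousOn
  obtain ⟨T, hT⟩ := hUb.exists_norm_le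
  exact ⟨x.re, y.re, T, (hUD hx).1, (hUD hy).2, fun s hs =>
    ⟨hmin (subset_closure hs), hmax (subset_closure hs),
      (Complex.abs_im_le_norm s).trans (hT s hs)⟩⟩

theorem integrable_conj_coeFn {U : Set ℂ} (hUb : Bornology.IsBounded U)
    (g : Lp ℂ 2 (volume.restrict U)) :
    Integrable (fun s => conj (g s)) (volume.restrict U) := by
  have : IsFiniteMeasure (volume.restrict U) :=
    ⟨by rw [Measure.restrict_apply_univ]; exact hUb.measure_lt_top⟩
  exact (Complex.conjCLE : ℂ →L[ℝ] ℂ).integrable_comp ((Lp.memLp g).integrable one_le_two)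

theorem bergmanTransform_eq_laplaceTransform {U : Set ℂ} (g : Lp ℂ 2 (volume.restrict U)) :
    bergmanTransform g = laplaceTransform (volume.restrict U) (fun s => conj (g s)) := rfl

theorem differentiable_bergmanTransform {U : Set ℂ} (hU : IsOpen U) (hUb : Bornology.IsBounded U)
    (g : Lp ℂ 2 (volume.restrict U)) : Differentiable ℂ (bergmanTransform g) := by
  obtain ⟨A, hA⟩ := hUb.exists_norm_le
  rw [bergmanTransform_eq_laplaceTransform]
  exact differentiable_laplaceTransform (integrable_conj_coeFn hUb g)
    ((ae_restrict_mem hU.measurableSet).mono hA)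

theorem exists_norm_bergmanTransform_le {U : Set ℂ} (hU : IsOpen U)
    (hUb : Bornology.IsBounded U) :
    ∃ A : ℝ, 0 ≤ A ∧ ∀ g : Lp ℂ 2 (volume.restrict U), ∃ C : ℝ, 0 ≤ C ∧
      ∀ z, ‖bergmanTransform g z‖ ≤ C * Real.exp (A * ‖z‖) := by
  obtain ⟨A, hA⟩ := hUb.exists_norm_le
  refine ⟨|A|, abs_nonneg A, fun g => ⟨∫ s in U, ‖conj (g s)‖, by positivity, fun z => ?_⟩⟩
  rw [bergmanTransform_eq_laplaceTransform]
  exact norm_laplaceTransform_le (integrable_conj_coeFn hUb g)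
    ((ae_restrict_mem hU.measurableSet).mono fun s hs => (hA s hs).trans (le_abs_self A)) z

/-- An element of the Bergman space whose transform is `O(e^{-bx})` on the positive axis, for some
`b` at least the right-hand abscissa of the strip, is zero: it is orthogonal to every function
analytic on the strip. -/
theorem eq_zero_of_bergmanTransform_decay {σ₁ σ₂ : ℝ} (hσ : σ₁ < σ₂) {U : Set ℂ} (hU : IsOpen U)
    (hUb : Bornology.IsBounded U) (hUD : closure U ⊆ verticalStrip σ₁ σ₂)
    (g : bergmanSpace (verticalStrip σ₁ σ₂) U) {b C : ℝ} (hb : σ₂ ≤ b)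
    (hdecay : ∀ x : ℝ, 0 ≤ x → ‖bergmanTransform (g : Lp ℂ 2 (volume.restrict U)) x‖
      ≤ C * Real.exp (-(b * x))) : g = 0 := by
  obtain ⟨α, β, T, hα, hβ, hUR⟩ := exists_subset_closedRect hσ hUb hUD
  obtain ⟨g, hg⟩ := g
  simp only at hdecay
  rw [bergmanTransform_eq_laplaceTransform] at hdecay
  have hw := integrable_conj_coeFn hUb g
  have hsupp : ∀ᵐ s ∂(volume.restrict U), s ∈ closedRect α β T :=
    (ae_restrict_mem hU.measurableSet).mono hUR
  have hzero : ∀ ζ, ζ ∉ closedRect α β T →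
      cauchyTransform (volume.restrict U) (fun s => conj (g s)) ζ = 0 := fun ζ hζ =>
    cauchyTransform_eq_zero_of_laplaceTransform_decay hw (hβ.trans_le hb) hsupp hdecay hζ
  have hDopen : IsOpen (verticalStrip σ₁ σ₂) :=
    (isOpen_lt continuous_const Complex.continuous_re).inter
      (isOpen_lt Complex.continuous_re continuous_const)
  have horth : g ∈ (analyticRestrictions (verticalStrip σ₁ σ₂) U)ᗮ := by
    rw [Submodule.mem_orthogonal']
    rintro f ⟨F, hF, hfF⟩
    rw [L2.inner_def]
    have := integral_holomorphic_mul_eq_zero hw (α' := (σ₁ + α) / 2) (β' := (β + σ₂) / 2)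
      (by linarith) (by linarith) hsupp hzero hDopen hF
      (fun s hs => ⟨by linarith [hs.1], by linarith [hs.2]⟩)
    rw [← this]
    refine integral_congr_ae ?_
    filter_upwards [hfF] with s hs
    rw [hs, RCLike.inner_apply]
  rw [← Submodule.orthogonal_closure] at horth
  have : g = 0 := by
    have h := Submodule.inner_right_of_mem_orthogonal hg horth
    exact inner_self_eq_zero.1 h
  exact Subtype.ext this

theorem exists_lt_norm_bergmanTransform {σ₁ σ₂ : ℝ} (hσ : σ₁ < σ₂) {U : Set ℂ} (hU : IsOpen U)
    (hUb : Bornology.IsBounded U) (hUD : closure U ⊆ verticalStrip σ₁ σ₂)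
    {g : bergmanSpace (verticalStrip σ₁ σ₂) U} (hg : g ≠ 0) {b : ℝ} (hb : σ₂ ≤ b) (Y : ℝ) :
    ∃ x : ℝ, Y ≤ x ∧
      Real.exp (-(b * x)) < ‖bergmanTransform (g : Lp ℂ 2 (volume.restrict U)) x‖ := by
  by_contra! hcon
  -- on the compact part `[0, Y]` the quotient by `e^{-bx}` is bounded
  have hcont : Continuous fun x : ℝ =>
      ‖bergmanTransform (g : Lp ℂ 2 (volume.restrict U)) x‖ * Real.exp (b * x) := by
    have := (differentiable_bergmanTransform hU hUb (g : Lp ℂ 2 (volume.restrict U))).continuous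
    fun_prop
  obtain ⟨B, hB⟩ := (isCompact_Icc (a := (0 : ℝ)) (b := Y)).bddAbove_image hcont.continuousOn
  refine hg (eq_zero_of_bergmanTransform_decay hσ hU hUb hUD g (C := max B 1) hb fun x hx => ?_)
  rcases le_or_gt Y x with h | h
  · exact (hcon x h).trans (le_mul_of_one_le_left (Real.exp_nonneg _) (le_max_right _ _))
  · have := hB ⟨x, ⟨hx, h.le⟩, rfl⟩
    rw [Real.exp_neg, ← div_eq_mul_inv, le_div_iff₀ (Real.exp_pos _)]
    exact this.trans (le_max_left _ _)

/-! ### Regular points of functions of exponential type -/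

/-- A function of at most exponential growth which is infinitely often larger than `e^{-bx}` has
arbitrarily large points at which it is still that large and where it dominates its values
elsewhere up to a factor `e^{κ|x-y|}`: maximise the function against the weight `e^{-κ|x-y₀|}`. -/
theorem exists_regular_point {N : ℝ → ℝ} (hN : Continuous N) {A C b : ℝ} (hA : 0 ≤ A)
    (hC : 0 ≤ C) (hb : 0 ≤ b)
    (hgrowth : ∀ x : ℝ, 0 ≤ x → N x ≤ C * Real.exp (A * x))
    (hlarge : ∀ Y : ℝ, ∃ x, Y ≤ x ∧ Real.exp (-(b * x)) < N x) (Y : ℝ) :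
    ∃ y, Y ≤ y ∧ Real.exp (-(b * y)) ≤ N y ∧
      ∀ x, 0 ≤ x → N x ≤ N y * Real.exp ((b + A + 1) * |x - y|) := by
  set κ : ℝ := b + A + 1 with hκ
  have hκ0 : 0 < κ := by positivity
  set Y' : ℝ := max Y 0 with hY'
  have hY'0 : 0 ≤ Y' := le_max_right _ _
  obtain ⟨y₀, hy₀, hy₀N⟩ := hlarge (Y' + κ * Y' + A * Y' + C)
  have hy₀0 : 0 ≤ y₀ := le_trans (by positivity) hy₀
  set φ : ℝ → ℝ := fun x => N x * Real.exp (-(κ * |x - y₀|)) with hφ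
  have hφy₀ : 0 < φ y₀ := by
    simp only [hφ, sub_self, abs_zero, mul_zero, neg_zero, Real.exp_zero, mul_one]
    exact (Real.exp_pos _).trans hy₀N
  have hφc : Continuous φ := by fun_prop
  -- the weighted function falls below its value at `y₀` beyond some `R`
  obtain ⟨R, hR, hR'⟩ : ∃ R, y₀ ≤ R ∧ ∀ x, R ≤ x → φ x ≤ φ y₀ := by
    have hlim : Tendsto (fun x : ℝ => C * Real.exp (κ * y₀) * Real.exp (-((b + 1) * x))) atTop
        (nhds (C * Real.exp (κ * y₀) * 0)) := by
      refine Tendsto.const_mul _ (Real.tendsto_exp_neg_atTop_nhds_zero.comp ?_)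
      exact tendsto_id.const_mul_atTop (by positivity)
    rw [mul_zero] at hlim
    obtain ⟨R, hR⟩ := eventually_atTop.1 (hlim.eventually (gt_mem_nhds hφy₀))
    refine ⟨max R y₀, le_max_right _ _, fun x hx => ?_⟩
    have hxy : y₀ ≤ x := (le_max_right _ _).trans hx
    refine le_trans ?_ (hR x ((le_max_left _ _).trans hx)).le
    simp only [hφ]
    rw [abs_of_nonneg (by linarith)]
    calc N x * Real.exp (-(κ * (x - y₀)))
        ≤ C * Real.exp (A * x) * Real.exp (-(κ * (x - y₀))) := by
          gcongr
          exact hgrowth x (by linarith)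
      _ = C * Real.exp (κ * y₀) * Real.exp (-((b + 1) * x)) := by
          rw [mul_assoc, mul_assoc, ← Real.exp_add, ← Real.exp_add]
          congr 2
          rw [hκ]; ring
  obtain ⟨y, hy, hmax⟩ := (isCompact_Icc (a := (0 : ℝ)) (b := R)).exists_isMaxOn
    ⟨y₀, hy₀0, hR⟩ hφc.continuousOn
  have hglob : ∀ x, 0 ≤ x → φ x ≤ φ y := by
    intro x hx
    rcases le_total x R with h | h
    · exact hmax ⟨hx, h⟩
    · exact (hR' x h).trans (hmax ⟨hy₀0, hR⟩)
  have hcmp : ∀ x, 0 ≤ x → N x * Real.exp (κ * (|y - y₀| - |x - y₀|)) ≤ N y := by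
    intro x hx
    have h := mul_le_mul_of_nonneg_right (hglob x hx) (Real.exp_nonneg (κ * |y - y₀|))
    simp only [hφ] at h
    rw [mul_assoc, mul_assoc, ← Real.exp_add, ← Real.exp_add, neg_add_cancel, Real.exp_zero,
      mul_one] at h
    refine le_trans (le_of_eq ?_) h
    ring_nf
  have hNy : Real.exp (-(b * y₀)) * Real.exp (κ * |y - y₀|) ≤ N y := by
    refine le_trans ?_ (hcmp y₀ hy₀0)
    rw [sub_self y₀, abs_zero, sub_zero]
    gcongr
  rw [← Real.exp_add] at hNy
  have hNy0 : 0 ≤ N y := (Real.exp_nonneg _).trans hNy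
  refine ⟨y, ?_, ?_, fun x hx => ?_⟩
  · by_contra! hlt
    have hyY : y < Y' := hlt.trans_le (le_max_left _ _)
    have h1 : N y ≤ Real.exp C * Real.exp (A * Y') := by
      refine (hgrowth y hy.1).trans ?_
      have : C ≤ Real.exp C := by linarith [Real.add_one_le_exp C]
      have := hyY.le
      gcongr
    rw [← Real.exp_add] at h1
    have h2 : C + A * Y' < -(b * y₀) + κ * |y - y₀| := by
      have h3 : y₀ - Y' ≤ |y - y₀| := by
        rw [abs_sub_comm]
        linarith [le_abs_self (y₀ - y)]
      have h4 := mul_le_mul_of_nonneg_left h3 hκ0.le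
      have h5 : κ * (y₀ - Y') = b * y₀ + A * y₀ + y₀ - κ * Y' := by rw [hκ]; ring
      have h6 : 0 ≤ A * y₀ := by positivity
      have h7 : 0 < Y' := hy.1.trans_lt hyY
      linarith
    exact absurd (h1.trans_lt (Real.exp_lt_exp.2 h2)) (not_lt.2 hNy)
  · refine le_trans (Real.exp_le_exp.2 ?_) hNy
    have h1 : b * (y₀ - y) ≤ κ * |y - y₀| := by
      calc b * (y₀ - y) ≤ b * |y - y₀| := by
            gcongr
            rw [abs_sub_comm]
            exact le_abs_self _
        _ ≤ κ * |y - y₀| := by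
            gcongr
            rw [hκ]; linarith
    linarith
  · have h := hcmp x hx
    rw [mul_sub, Real.exp_sub, mul_div_assoc', div_le_iff₀ (Real.exp_pos _)] at h
    have h2 : |x - y₀| ≤ |x - y| + |y - y₀| := abs_sub_le x y y₀
    have h3 : N y * Real.exp (κ * |x - y₀|)
        ≤ N y * Real.exp (κ * |x - y|) * Real.exp (κ * |y - y₀|) := by
      rw [mul_assoc, ← Real.exp_add, ← mul_add]
      gcongr
    exact le_of_mul_le_mul_right (h.trans h3) (Real.exp_pos _)

/-- A two-constants estimate: a function holomorphic in the half-square `|Re z - y| ≤ 1`,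
`0 ≤ Im z ≤ 1`, bounded by `B` on the real side and by `B e^{Ny}` throughout, is bounded by
`B e^{3N}` at distance `1 / y` from the midpoint `y` of that side. The comparison function is the
harmonic polynomial `(Re z - y)² - (Im z)² + 2 Im z`. -/
theorem norm_le_of_norm_le_real_upper {f : ℂ → ℂ} (hf : Differentiable ℂ f) {B N y : ℝ}
    (hN : 0 ≤ N) (hy : 1 ≤ y)
    (hreal : ∀ x : ℝ, |x - y| ≤ 1 → ‖f x‖ ≤ B)
    (hbox : ∀ z : ℂ, |z.re - y| ≤ 1 → |z.im| ≤ 1 → ‖f z‖ ≤ B * Real.exp (N * y))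
    {z : ℂ} (hz : ‖z - y‖ ≤ 1 / y) (him : 0 ≤ z.im) : ‖f z‖ ≤ B * Real.exp (3 * N) := by
  have hy0 : 0 < y := by linarith
  have hB : 0 ≤ B := (norm_nonneg _).trans (hreal y (by simp))
  set G : ℂ → ℂ := fun z => f z *
    Complex.exp (-(N * y) * ((z - y) ^ 2 - 2 * Complex.I * (z - y))) with hG
  have hnorm : ∀ z : ℂ, ‖G z‖
      = ‖f z‖ * Real.exp (-(N * y) * ((z.re - y) ^ 2 - z.im ^ 2 + 2 * z.im)) := by
    intro z
    rw [hG]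
    simp only [norm_mul, Complex.norm_exp]
    congr 2
    simp [pow_two]
  set S : Set ℂ := Set.Ioo (y - 1) (y + 1) ×ℂ Set.Ioo 0 1 with hS
  have hSb : Bornology.IsBounded S :=
    Bornology.IsBounded.reProdIm (Metric.isBounded_Ioo _ _) (Metric.isBounded_Ioo _ _)
  have hcl : closure S = Set.Icc (y - 1) (y + 1) ×ℂ Set.Icc 0 1 := by
    rw [hS, Complex.closure_reProdIm, closure_Ioo (by linarith), closure_Ioo (by norm_num)]
  have hfr : ∀ w ∈ frontier S, ‖G w‖ ≤ B := by
    intro w hw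
    have hlt : y - 1 < y + 1 := by linarith
    rw [hS, Complex.frontier_reProdIm, frontier_Ioo hlt, frontier_Ioo one_pos,
      closure_Ioo hlt.ne, closure_Ioo one_pos.ne] at hw
    rw [hnorm]
    have hNy : 0 ≤ N * y := by positivity
    -- away from the real side the comparison function is at least `1`
    have hother : |w.re - y| ≤ 1 → |w.im| ≤ 1 → 1 ≤ (w.re - y) ^ 2 - w.im ^ 2 + 2 * w.im →
        ‖f w‖ * Real.exp (-(N * y) * ((w.re - y) ^ 2 - w.im ^ 2 + 2 * w.im)) ≤ B := by
      intro h1 h2 h3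
      calc ‖f w‖ * Real.exp (-(N * y) * ((w.re - y) ^ 2 - w.im ^ 2 + 2 * w.im))
          ≤ B * Real.exp (N * y) * Real.exp (-(N * y)) := by
            gcongr
            · exact hbox w h1 h2
            · nlinarith
        _ = B := by rw [mul_assoc, ← Real.exp_add, add_neg_cancel, Real.exp_zero, mul_one]
    rcases hw with ⟨⟨h1, h2⟩, h3⟩ | ⟨h1, ⟨h2, h3⟩⟩
    · rcases h3 with h3 | h3
      · have h3' : w.im = 0 := h3
        have hw : w = (w.re : ℂ) := by apply Complex.ext <;> simp [h3']
        have h4 : ‖f w‖ ≤ B := by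
          rw [hw]
          exact hreal _ (abs_le.2 ⟨by linarith, by linarith⟩)
        have h5 : Real.exp (-(N * y) * ((w.re - y) ^ 2 - w.im ^ 2 + 2 * w.im)) ≤ 1 := by
          rw [Real.exp_le_one_iff, h3']
          have := mul_nonneg hNy (sq_nonneg (w.re - y))
          linarith
        exact (mul_le_of_le_one_right (norm_nonneg _) h5).trans h4
      · have h3' : w.im = 1 := h3
        refine hother (abs_le.2 ⟨by linarith, by linarith⟩) (by simp [h3']) ?_
        rw [h3']
        nlinarith [sq_nonneg (w.re - y)]
    · have h4 : (w.re - y) ^ 2 = 1 := by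
        rcases h1 with h1 | h1
        · have : w.re = y - 1 := h1
          rw [this]; ring
        · have : w.re = y + 1 := h1
          rw [this]; ring
      refine hother ?_ (abs_le.2 ⟨by linarith, h3⟩) ?_
      · exact (sq_le_one_iff_abs_le_one _).1 h4.le
      · rw [h4]
        nlinarith
  have hGd : Differentiable ℂ G := by
    rw [hG]; fun_prop
  have h1y : 1 / y ≤ 1 := by rw [div_le_one hy0]; exact hy
  have hre : |z.re - y| ≤ 1 / y := by
    have := Complex.abs_re_le_norm (z - y)
    simp only [Complex.sub_re, Complex.ofReal_re] at this
    exact this.trans hz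
  have him' : |z.im| ≤ 1 / y := by
    have := Complex.abs_im_le_norm (z - y)
    simp only [Complex.sub_im, Complex.ofReal_im, sub_zero] at this
    exact this.trans hz
  have hzcl : z ∈ closure S := by
    rw [hcl]
    have h1 := abs_le.1 (hre.trans h1y)
    exact ⟨⟨by linarith [h1.1], by linarith [h1.2]⟩, him, (le_abs_self _).trans (him'.trans h1y)⟩
  have hGz := Complex.norm_le_of_forall_mem_frontier_norm_le hSb hGd.diffContOnCl hfr hzcl
  rw [hnorm] at hGz
  have hexp : N * y * ((z.re - y) ^ 2 - z.im ^ 2 + 2 * z.im) ≤ 3 * N := by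
    have h1 : (z.re - y) ^ 2 ≤ 1 / y := by
      rw [← sq_abs]
      nlinarith [abs_nonneg (z.re - y)]
    have h2 : z.im ≤ 1 / y := (le_abs_self _).trans him'
    have h3 : (z.re - y) ^ 2 - z.im ^ 2 + 2 * z.im ≤ 3 * (1 / y) := by nlinarith [sq_nonneg z.im]
    calc N * y * ((z.re - y) ^ 2 - z.im ^ 2 + 2 * z.im) ≤ N * y * (3 * (1 / y)) := by gcongr
      _ = 3 * N := by field_simp
  calc ‖f z‖ = ‖f z‖ * Real.exp (-(N * y) * ((z.re - y) ^ 2 - z.im ^ 2 + 2 * z.im))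
        * Real.exp (N * y * ((z.re - y) ^ 2 - z.im ^ 2 + 2 * z.im)) := by
        rw [mul_assoc, ← Real.exp_add, neg_mul, neg_add_cancel, Real.exp_zero, mul_one]
    _ ≤ B * Real.exp (3 * N) := by gcongr

/-- The two-constants estimate on both sides of the real axis, by reflection. -/
theorem norm_le_of_norm_le_real {f : ℂ → ℂ} (hf : Differentiable ℂ f) {B N y : ℝ}
    (hN : 0 ≤ N) (hy : 1 ≤ y)
    (hreal : ∀ x : ℝ, |x - y| ≤ 1 → ‖f x‖ ≤ B)
    (hbox : ∀ z : ℂ, |z.re - y| ≤ 1 → |z.im| ≤ 1 → ‖f z‖ ≤ B * Real.exp (N * y))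
    {z : ℂ} (hz : ‖z - y‖ ≤ 1 / y) : ‖f z‖ ≤ B * Real.exp (3 * N) := by
  rcases le_total 0 z.im with him | him
  · exact norm_le_of_norm_le_real_upper hf hN hy hreal hbox hz him
  · have hf' : Differentiable ℂ (conj ∘ f ∘ conj) := fun w =>
      differentiableAt_conj_conj_iff.2 (hf _)
    have := norm_le_of_norm_le_real_upper hf' (B := B) hN hy (fun x hx => ?_) (fun w h1 h2 => ?_)
      (z := conj z) ?_ (by simpa using him)
    · simpa using this
    · simpa using hreal x hx
    · simpa using hbox (conj w) (by simpa using h1) (by simpa using h2)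
    · rw [← Complex.conj_ofReal, ← map_sub, Complex.norm_conj]
      exact hz

/-- Near a regular point `y` a function of exponential type has derivative `O(yM)`, where `M` is the
size at `y` and the constant depends only on the growth parameters. -/
theorem exists_norm_sub_le_of_regular_point {A C b κ : ℝ} (hA : 0 ≤ A) (hC : 0 ≤ C) (hb : 0 ≤ b)
    (hκ : 0 ≤ κ) :
    ∃ K : ℝ, 0 < K ∧ ∀ f : ℂ → ℂ, Differentiable ℂ f →
      (∀ z, ‖f z‖ ≤ C * Real.exp (A * ‖z‖)) →
      ∀ y M : ℝ, 1 ≤ y → Real.exp (-(b * y)) ≤ M →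
      (∀ x : ℝ, 0 ≤ x → ‖f x‖ ≤ M * Real.exp (κ * |x - y|)) →
      ∀ x : ℝ, |x - y| ≤ 1 / (2 * y) → ‖f x - f y‖ ≤ K * y * M * |x - y| := by
  set N : ℝ := C + 3 * A + b with hN
  refine ⟨2 * Real.exp (κ + 3 * N), by positivity, fun f hf hgrowth y M hy hM hreg x hx => ?_⟩
  have hy0 : 0 < y := by linarith
  have hM0 : 0 ≤ M := (Real.exp_nonneg _).trans hM
  have hnear : ∀ z : ℂ, ‖z - y‖ ≤ 1 / y → ‖f z‖ ≤ M * Real.exp κ * Real.exp (3 * N) := by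
    intro z hz
    refine norm_le_of_norm_le_real hf (by positivity) hy (fun x hx => ?_) (fun w h1 h2 => ?_) hz
    · refine (hreg x (by linarith [(abs_le.1 hx).1])).trans ?_
      have : κ * |x - y| ≤ κ := mul_le_of_le_one_right hκ hx
      gcongr
    · have hw : ‖w‖ ≤ y + 2 := by
        have h3 := Complex.norm_le_abs_re_add_abs_im w
        have h4 : |w.re| ≤ y + 1 := abs_le.2 ⟨by linarith [(abs_le.1 h1).1],
          by linarith [(abs_le.1 h1).2]⟩
        linarith
      have hexp : C + A * (y + 2) ≤ -(b * y) + κ + N * y := by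
        have : N * y = C * y + 3 * (A * y) + b * y := by rw [hN]; ring
        nlinarith
      calc ‖f w‖ ≤ C * Real.exp (A * ‖w‖) := hgrowth w
        _ ≤ Real.exp C * Real.exp (A * (y + 2)) := by
            have : C ≤ Real.exp C := by linarith [Real.add_one_le_exp C]
            gcongr
        _ ≤ Real.exp (-(b * y)) * Real.exp κ * Real.exp (N * y) := by
            rw [← Real.exp_add, ← Real.exp_add, ← Real.exp_add]
            exact Real.exp_le_exp.2 hexp
        _ ≤ M * Real.exp κ * Real.exp (N * y) := by gcongr
  have hr : 0 < 1 / (2 * y) := by positivity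
  have hrr : 1 / (2 * y) + 1 / (2 * y) = 1 / y := by field_simp; norm_num
  have hderiv : ∀ z ∈ Metric.closedBall (y : ℂ) (1 / (2 * y)),
      ‖deriv f z‖ ≤ 2 * Real.exp (κ + 3 * N) * y * M := by
    intro z hz
    have h := Complex.norm_deriv_le_of_forall_mem_sphere_norm_le hr hf.diffContOnCl
      (C := M * Real.exp κ * Real.exp (3 * N)) (c := z) (fun w hw => hnear w ?_)
    · refine h.trans (le_of_eq ?_)
      rw [Real.exp_add]
      field_simp
    · rw [← dist_eq_norm, ← hrr]
      exact (dist_triangle w z y).trans (add_le_add (Metric.mem_sphere.1 hw).le hz)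
  have := (convex_closedBall (y : ℂ) (1 / (2 * y))).norm_image_sub_le_of_norm_deriv_le
    (fun z _ => hf.differentiableAt) hderiv (Metric.mem_closedBall_self hr.le)
    (y := (x : ℂ)) (by rwa [Metric.mem_closedBall, dist_eq_norm, ← Complex.ofReal_sub,
      Complex.norm_real, Real.norm_eq_abs])
  rwa [← Complex.ofReal_sub, Complex.norm_real, Real.norm_eq_abs] at this

/-! ### Prime sums over short windows -/

/-- The primes `p` with `y < log p ≤ y + η / y`, written with floors so that sums over them are
differences of values of `primeSum`. -/
noncomputable def primeWindow (η y : ℝ) : Finset ℕ :=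
  (Finset.Ioc ⌊Real.exp y⌋₊ ⌊Real.exp (y + η / y)⌋₊).filter Nat.Prime

theorem prime_of_mem_primeWindow {η y : ℝ} {p : ℕ} (hp : p ∈ primeWindow η y) : p.Prime :=
  (Finset.mem_filter.1 hp).2

theorem exp_lt_of_mem_primeWindow {η y : ℝ} {p : ℕ} (hp : p ∈ primeWindow η y) :
    Real.exp y < p :=
  Nat.lt_of_floor_lt (Finset.mem_Ioc.1 (Finset.mem_filter.1 hp).1).1

theorem le_exp_of_mem_primeWindow {η y : ℝ} {p : ℕ} (hp : p ∈ primeWindow η y) :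
    (p : ℝ) ≤ Real.exp (y + η / y) :=
  (Nat.le_floor_iff (Real.exp_nonneg _)).1 (Finset.mem_Ioc.1 (Finset.mem_filter.1 hp).1).2

theorem log_mem_of_mem_primeWindow {η y : ℝ} {p : ℕ} (hp : p ∈ primeWindow η y) :
    y < Real.log p ∧ Real.log p ≤ y + η / y := by
  have hp0 : (0 : ℝ) < p := (Real.exp_pos y).trans (exp_lt_of_mem_primeWindow hp)
  exact ⟨(Real.lt_log_iff_exp_lt hp0).2 (exp_lt_of_mem_primeWindow hp),
    (Real.log_le_iff_le_exp hp0).2 (le_exp_of_mem_primeWindow hp)⟩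

theorem primeSum_sub_primeSum {M : Type*} [AddCommGroup M] (f : ℕ → M) {η y : ℝ} (hη : 0 ≤ η)
    (hy : 0 ≤ y) :
    primeSum f (Real.exp (y + η / y)) - primeSum f (Real.exp y) = ∑ p ∈ primeWindow η y, f p := by
  have hle : ⌊Real.exp y⌋₊ ≤ ⌊Real.exp (y + η / y)⌋₊ := by
    apply Nat.floor_le_floor
    apply Real.exp_le_exp.2
    have : 0 ≤ η / y := by positivity
    linarith
  have hIcc : ∀ n : ℕ, Finset.Icc 1 n = Finset.Ioc 0 n := fun n => by
    ext k; simp [Nat.succ_le_iff]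
  simp only [primeSum, primeWindow, hIcc, Finset.sum_filter]
  rw [sub_eq_iff_eq_add', Finset.sum_Ioc_consecutive _ (Nat.zero_le _) hle]

theorem tendsto_add_div_self_atTop (η : ℝ) :
    Tendsto (fun y : ℝ => y + η / y) atTop atTop :=
  tendsto_id.atTop_add (tendsto_const_nhds.div_atTop tendsto_id)

theorem tendsto_self_div_add_div_self (η : ℝ) :
    Tendsto (fun y : ℝ => y / (y + η / y)) atTop (nhds 1) := by
  have h0 : Tendsto (fun y : ℝ => η / y) atTop (nhds 0) := tendsto_const_nhds.div_atTop tendsto_id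
  have h1 : Tendsto (fun y : ℝ => (1 + η / y / y)⁻¹) atTop (nhds 1) := by
    have h2 : Tendsto (fun y : ℝ => 1 + η / y / y) atTop (nhds (1 + 0)) :=
      (h0.div_atTop tendsto_id).const_add 1
    rw [add_zero] at h2
    simpa only [inv_one] using h2.inv₀ one_ne_zero
  refine h1.congr' ?_
  filter_upwards [eventually_gt_atTop 0] with y hy
  have : 1 + η / y / y = (y + η / y) / y := by field_simp
  rw [this, inv_div]

/-- With `y' = y + η/y`, the weights `y² e^{-y}` and `y'² e^{-y'}` are asymptotically equal. -/
theorem tendsto_weight_ratio (η : ℝ) :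
    Tendsto (fun y : ℝ => (y / (y + η / y)) ^ 2 * Real.exp (η / y)) atTop (nhds 1) := by
  have h0 : Tendsto (fun y : ℝ => η / y) atTop (nhds 0) := tendsto_const_nhds.div_atTop tendsto_id
  have h1 : Tendsto (fun y : ℝ => Real.exp (η / y)) atTop (nhds 1) := by
    have := (Real.continuous_exp.tendsto 0).comp h0
    rwa [Real.exp_zero] at this
  simpa using ((tendsto_self_div_add_div_self η).pow 2).mul h1

theorem tendsto_smul_comp_add_div {u : ℝ → ℂ} {ℓ : ℂ} (η : ℝ)
    (hu : Tendsto (fun y : ℝ => (y ^ 2 * Real.exp (-y)) • u y) atTop (nhds ℓ)) :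
    Tendsto (fun y : ℝ => (y ^ 2 * Real.exp (-y)) • u (y + η / y)) atTop (nhds ℓ) := by
  have h := (tendsto_weight_ratio η).smul (hu.comp (tendsto_add_div_self_atTop η))
  rw [one_smul] at h
  refine h.congr' ?_
  filter_upwards [(tendsto_add_div_self_atTop η).eventually_gt_atTop 0] with y hy
  simp only [Function.comp, smul_smul]
  congr 1
  rw [neg_add, Real.exp_add, Real.exp_neg (η / y)]
  have := (Real.exp_pos (η / y)).ne'
  generalize y + η / y = y' at hy
  field_simp

/-- The main term: the increment of `e^y / y` over `[y, y + η/y]` is `~ η e^y / y²`. -/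
theorem tendsto_weight_mul_exp_div_sub (η : ℝ) :
    Tendsto (fun y : ℝ => y ^ 2 * Real.exp (-y) *
      (Real.exp (y + η / y) / (y + η / y) - Real.exp y / y)) atTop (nhds η) := by
  have h0 : Tendsto (fun y : ℝ => η / y) atTop (nhds 0) := tendsto_const_nhds.div_atTop tendsto_id
  have hexp : Tendsto (fun y : ℝ => y * (Real.exp (η / y) - 1)) atTop (nhds η) := by
    have hd : HasDerivAt (fun t : ℝ => Real.exp (η * t)) η 0 := by
      simpa using ((hasDerivAt_id (0 : ℝ)).const_mul η).exp
    have := (hasDerivAt_iff_tendsto_slope.1 hd).comp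
      (tendsto_nhdsWithin_mono_right (s := Set.Ioi 0) (fun x hx => (ne_of_gt hx :))
        (tendsto_inv_atTop_nhdsGT_zero (𝕜 := ℝ)))
    refine this.congr fun y => ?_
    simp [slope_def_field, div_eq_mul_inv, mul_comm]
  have h := (tendsto_self_div_add_div_self η).mul (hexp.sub h0)
  simp only [one_mul, sub_zero] at h
  refine h.congr' ?_
  filter_upwards [eventually_gt_atTop 0,
    (tendsto_add_div_self_atTop η).eventually_gt_atTop 0] with y hy hy'
  rw [Real.exp_add, Real.exp_neg]
  have := (Real.exp_pos y).ne'
  have h2 : y ^ 2 + η ≠ 0 := by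
    have : y * (y + η / y) = y ^ 2 + η := by field_simp
    rw [← this]; positivity
  field_simp
  ring

theorem tendsto_sq_mul_inv_pow {j : ℕ} (hj : 2 ≤ j) :
    ∃ ℓ : ℝ, Tendsto (fun y : ℝ => y ^ 2 / y ^ j) atTop (nhds ℓ) := by
  rcases hj.eq_or_lt with rfl | hj
  · refine ⟨1, tendsto_const_nhds.congr' ?_⟩
    filter_upwards [eventually_gt_atTop 0] with y hy
    rw [div_self (by positivity)]
  · exact ⟨0, tendsto_pow_div_pow_atTop_zero hj⟩

/-- An asymptotic expansion of `S(x)` in powers of `1 / log x` with at least two terms determines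
the increment of `S` from `x = e^y` to `e^{y + η/y}` up to `o(e^y / y²)`; only the first term
contributes. -/
theorem tendsto_increment_of_expansion {S : ℝ → ℂ} {c : ℕ → ℂ} {J : ℕ} (hJ : 2 ≤ J)
    (h : (fun x : ℝ => S x - ∑ j ∈ Finset.Icc 1 J, c j * (x : ℂ) / (Real.log x : ℂ) ^ j)
      =O[atTop] fun x : ℝ => x / Real.log x ^ (J + 1)) (η : ℝ) :
    Tendsto (fun y : ℝ => (y ^ 2 * Real.exp (-y)) •
      (S (Real.exp (y + η / y)) - S (Real.exp y))) atTop (nhds (c 1 * η)) := by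
  -- the expansion without its first term is asymptotic to a multiple of `e^y / y²`
  set u : ℝ → ℂ := fun y => S (Real.exp y) - c 1 * ((Real.exp y / y : ℝ) : ℂ) with hu
  have hlim : ∃ ℓ, Tendsto (fun y : ℝ => (y ^ 2 * Real.exp (-y)) • u y) atTop (nhds ℓ) := by
    have herr : Tendsto (fun y : ℝ => (y ^ 2 * Real.exp (-y)) • (S (Real.exp y)
        - ∑ j ∈ Finset.Icc 1 J, c j * (Real.exp y : ℂ) / (y : ℂ) ^ j)) atTop (nhds 0) := by
      have h1 := (h.comp_tendsto Real.tendsto_exp_atTop)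
      simp only [Function.comp_def, Real.log_exp] at h1
      have h2 := (isBigO_refl (fun y : ℝ => y ^ 2 * Real.exp (-y)) atTop).smul h1
      refine h2.trans_tendsto ?_
      refine (tendsto_pow_div_pow_atTop_zero (𝕜 := ℝ) (by omega : 2 < J + 1)).congr fun y => ?_
      rw [smul_eq_mul, Real.exp_neg]
      have := (Real.exp_pos y).ne'
      field_simp
    choose! ℓ hℓ using fun j (hj : 2 ≤ j) => tendsto_sq_mul_inv_pow hj
    have hsum : Tendsto (fun y : ℝ => ∑ j ∈ Finset.Icc 2 J, c j * ((y ^ 2 / y ^ j : ℝ) : ℂ)) atTop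
        (nhds (∑ j ∈ Finset.Icc 2 J, c j * (ℓ j : ℂ))) := by
      refine tendsto_finsetSum _ fun j hj => Tendsto.const_mul _ ?_
      exact (Complex.continuous_ofReal.tendsto _).comp (hℓ j (Finset.mem_Icc.1 hj).1)
    refine ⟨_, (herr.add hsum).congr fun y => ?_⟩
    have hsplit : ∑ j ∈ Finset.Icc 1 J, c j * (Real.exp y : ℂ) / (y : ℂ) ^ j
        = c 1 * ((Real.exp y / y : ℝ) : ℂ)
          + ∑ j ∈ Finset.Icc 2 J, c j * (Real.exp y : ℂ) / (y : ℂ) ^ j := by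
      rw [← Finset.insert_Icc_add_one_left_eq_Icc (by omega : 1 ≤ J), Finset.sum_insert (by simp)]
      push_cast
      ring
    have hterm : ∑ j ∈ Finset.Icc 2 J, c j * ((y ^ 2 / y ^ j : ℝ) : ℂ)
        = (y ^ 2 * Real.exp (-y)) • ∑ j ∈ Finset.Icc 2 J, c j * (Real.exp y : ℂ) / (y : ℂ) ^ j := by
      rw [Finset.smul_sum]
      refine Finset.sum_congr rfl fun j _ => ?_
      rw [Complex.real_smul]
      push_cast
      rw [Complex.exp_neg]
      have := Complex.exp_ne_zero (y : ℂ)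
      field_simp
    rw [hterm, ← smul_add, hu, hsplit]
    congr 1
    ring
  obtain ⟨ℓ, hℓ⟩ := hlim
  have hdiff := (tendsto_smul_comp_add_div η hℓ).sub hℓ
  have hmain := ((Complex.continuous_ofReal.tendsto _).comp
    (tendsto_weight_mul_exp_div_sub η)).const_mul (c 1)
  have := hdiff.add hmain
  rw [sub_self, zero_add] at this
  refine this.congr fun y => ?_
  simp only [hu, Function.comp, Complex.real_smul]
  push_cast
  ring

/-- The sums `∑ a_k(p) conj(a_l(p))` over the primes with `y < log p ≤ y + η/y`, in units of
`e^y / y²`, tend to a positive diagonal matrix. -/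
theorem tendsto_window_gram {m : ℕ} (hm : 1 ≤ m) {a : Fin m → ℕ → ℂ}
    (hSA : ∀ k, SelbergDiagonal m (a k))
    (hSB : ∀ k l, k ≠ l → SelbergOrthogonal m (a k) (a l)) :
    ∃ c : Fin m → ℝ, (∀ k, 0 < c k) ∧ ∀ η : ℝ, 0 ≤ η → ∀ k l,
      Tendsto (fun y : ℝ => (y ^ 2 * Real.exp (-y)) •
        ∑ p ∈ primeWindow η y, a k p * conj (a l p)) atTop
        (nhds (if k = l then ((c k * η : ℝ) : ℂ) else 0)) := by
  choose c hc hcO using hSA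
  refine ⟨fun k => c k 1, hc, fun η hη k l => ?_⟩
  have hkey : ∀ {d : ℕ → ℂ},
      ((fun x : ℝ => primeSum (fun p => a k p * conj (a l p)) x
        - ∑ j ∈ Finset.Icc 1 (2 * m + 1), d j * (x : ℂ) / (Real.log x : ℂ) ^ j)
        =O[atTop] fun x : ℝ => x / Real.log x ^ (2 * m + 2)) →
      Tendsto (fun y : ℝ => (y ^ 2 * Real.exp (-y)) •
        ∑ p ∈ primeWindow η y, a k p * conj (a l p)) atTop (nhds (d 1 * η)) := by
    intro d hd
    refine (tendsto_increment_of_expansion (by omega : 2 ≤ 2 * m + 1) hd η).congr' ?_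
    filter_upwards [eventually_ge_atTop 0] with y hy
    rw [primeSum_sub_primeSum _ hη hy]
  split_ifs with hkl
  · subst hkl
    have := hkey (d := fun j => (c k j : ℂ)) (by
      refine IsBigO.congr_left (Complex.isBigO_ofReal_left.2 (hcO k)) fun x => ?_
      simp only [primeSum, Complex.mul_conj, Complex.normSq_eq_norm_sq]
      push_cast
      rfl)
    simpa using this
  · obtain ⟨d, hd⟩ := hSB k l hkl
    have := hkey (d := fun j => if j = 1 then 0 else d j) (by
      refine hd.congr_left fun x => ?_
      rw [← Finset.insert_Icc_add_one_left_eq_Icc (by omega : 1 ≤ 2 * m + 1),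
        Finset.sum_insert (by simp)]
      simp only [if_true, zero_mul, zero_div, zero_add]
      congr 1
      refine Finset.sum_congr rfl fun j hj => ?_
      rw [if_neg (by have := (Finset.mem_Icc.1 hj).1; omega)])
    simpa using this

/-! ### Divergence from large values of the transforms -/

theorem sum_norm_sq_sum_mul_eq {m : ℕ} (a : Fin m → ℕ → ℂ) (W : Finset ℕ) (v : Fin m → ℂ) :
    ((∑ p ∈ W, ‖∑ j, a j p * v j‖ ^ 2 : ℝ) : ℂ)
      = ∑ k, ∑ l, v k * conj (v l) * ∑ p ∈ W, a k p * conj (a l p) := by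
  have h : ∀ p, ((‖∑ j, a j p * v j‖ ^ 2 : ℝ) : ℂ)
      = ∑ k, ∑ l, v k * conj (v l) * (a k p * conj (a l p)) := fun p => by
    rw [← Complex.normSq_eq_norm_sq, ← Complex.mul_conj, map_sum, Finset.sum_mul_sum]
    refine Finset.sum_congr rfl fun k _ => Finset.sum_congr rfl fun l _ => ?_
    rw [map_mul]
    ring
  rw [Complex.ofReal_sum]
  simp only [h, Finset.mul_sum]
  rw [Finset.sum_comm]
  refine Finset.sum_congr rfl fun k _ => ?_
  rw [Finset.sum_comm]

theorem norm_sq_le_sum_norm_sq {m : ℕ} (v : Fin m → ℂ) : ‖v‖ ^ 2 ≤ ∑ k, ‖v k‖ ^ 2 := by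
  have h : ‖v‖ ≤ Real.sqrt (∑ k, ‖v k‖ ^ 2) := by
    refine (pi_norm_le_iff_of_nonneg (Real.sqrt_nonneg _)).2 fun k => ?_
    refine Real.le_sqrt_of_sq_le ?_
    exact Finset.single_le_sum (f := fun k => ‖v k‖ ^ 2) (fun _ _ => by positivity)
      (Finset.mem_univ k)
  calc ‖v‖ ^ 2 ≤ Real.sqrt (∑ k, ‖v k‖ ^ 2) ^ 2 := by gcongr
    _ = _ := Real.sq_sqrt (by positivity)

/-- The coefficient vectors are asymptotically orthogonal on the windows: the quadratic forms
`v ↦ ∑_p |∑_j a_j(p) v_j|²` are bounded below by a multiple of `η (e^y / y²) ‖v‖²`, uniformly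
in `v`. -/
theorem exists_window_bounds {m : ℕ} (hm : 1 ≤ m) {a : Fin m → ℕ → ℂ}
    (hSA : ∀ k, SelbergDiagonal m (a k))
    (hSB : ∀ k l, k ≠ l → SelbergOrthogonal m (a k) (a l)) :
    ∃ c B : ℝ, 0 < c ∧ 0 < B ∧ ∀ η : ℝ, 0 < η → ∀ᶠ y : ℝ in atTop,
      (∀ v : Fin m → ℂ, c * η * ‖v‖ ^ 2 ≤
        y ^ 2 * Real.exp (-y) * ∑ p ∈ primeWindow η y, ‖∑ j, a j p * v j‖ ^ 2) ∧
      ∀ j, y ^ 2 * Real.exp (-y) * ∑ p ∈ primeWindow η y, ‖a j p‖ ^ 2 ≤ B * η := by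
  obtain ⟨c, hc, hlim⟩ := tendsto_window_gram hm hSA hSB
  have : Nonempty (Fin m) := ⟨⟨0, hm⟩⟩
  obtain ⟨i, hi⟩ := Finite.exists_min c
  obtain ⟨i', hi'⟩ := Finite.exists_max c
  have hm0 : (0 : ℝ) < m := by exact_mod_cast hm
  refine ⟨c i / 2, 2 * c i', half_pos (hc i), by linarith [hc i'], fun η hη => ?_⟩
  set ε : ℝ := c i * η / (2 * m ^ 2) with hε
  have hε0 : 0 < ε := by have := hc i; positivity
  have hev : ∀ᶠ y : ℝ in atTop, ∀ k l, ‖(y ^ 2 * Real.exp (-y)) •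
      (∑ p ∈ primeWindow η y, a k p * conj (a l p))
        - (if k = l then ((c k * η : ℝ) : ℂ) else 0)‖ < ε := by
    refine eventually_all.2 fun k => eventually_all.2 fun l => ?_
    have := tendsto_iff_norm_sub_tendsto_zero.1 (hlim η hη.le k l)
    exact this.eventually (gt_mem_nhds hε0)
  filter_upwards [hev] with y hy
  set q : ℝ := y ^ 2 * Real.exp (-y) with hq
  refine ⟨fun v => ?_, fun j => ?_⟩
  · set E : Fin m → Fin m → ℂ := fun k l => q • (∑ p ∈ primeWindow η y, a k p * conj (a l p))
        - (if k = l then ((c k * η : ℝ) : ℂ) else 0) with hE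
    have hexpand : ((q * ∑ p ∈ primeWindow η y, ‖∑ j, a j p * v j‖ ^ 2 : ℝ) : ℂ)
        = ((∑ k, c k * η * ‖v k‖ ^ 2 : ℝ) : ℂ) + ∑ k, ∑ l, v k * conj (v l) * E k l := by
      rw [Complex.ofReal_mul, sum_norm_sq_sum_mul_eq, Complex.ofReal_sum, ← Finset.sum_add_distrib,
        Finset.mul_sum]
      refine Finset.sum_congr rfl fun k _ => ?_
      simp only [hE, mul_sub, Finset.sum_sub_distrib, mul_ite, mul_zero, Finset.sum_ite_eq,
        Finset.mem_univ, if_true, Complex.mul_conj, Complex.normSq_eq_norm_sq,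
        Complex.real_smul]
      rw [Finset.mul_sum]
      push_cast
      have : ∀ x t z : ℂ, x = t → x = z + (t - z) := fun x t z h => by rw [h]; ring
      rw [mul_comm ((c k : ℂ) * η)]
      refine this _ _ _ (Finset.sum_congr rfl fun l _ => ?_)
      ring
    have herr : ‖∑ k, ∑ l, v k * conj (v l) * E k l‖ ≤ c i / 2 * η * ‖v‖ ^ 2 := by
      calc ‖∑ k, ∑ l, v k * conj (v l) * E k l‖
          ≤ ∑ _k : Fin m, ∑ _l : Fin m, ‖v‖ * ‖v‖ * ε := by
            refine norm_sum_le_of_le _ fun k _ => norm_sum_le_of_le _ fun l _ => ?_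
            rw [norm_mul, norm_mul, Complex.norm_conj]
            gcongr
            · exact norm_le_pi_norm v k
            · exact norm_le_pi_norm v l
            · exact (hy k l).le
        _ = c i / 2 * η * ‖v‖ ^ 2 := by
            simp only [Finset.sum_const, Finset.card_univ, Fintype.card_fin, nsmul_eq_mul, hε]
            field_simp
    have hmain : c i * η * ‖v‖ ^ 2 ≤ ∑ k, c k * η * ‖v k‖ ^ 2 := by
      calc c i * η * ‖v‖ ^ 2 ≤ c i * η * ∑ k, ‖v k‖ ^ 2 := by
            have := hc i
            gcongr
            exact norm_sq_le_sum_norm_sq v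
        _ = ∑ k, c i * η * ‖v k‖ ^ 2 := Finset.mul_sum _ _ _
        _ ≤ _ := by
            gcongr with k
            exact hi k
    have hre := congrArg Complex.re hexpand
    rw [Complex.add_re, Complex.ofReal_re, Complex.ofReal_re] at hre
    have := (abs_le.1 (Complex.abs_re_le_norm (∑ k, ∑ l, v k * conj (v l) * E k l))).1
    linarith
  · have h := hy j j
    rw [if_pos rfl] at h
    have h1 : q • (∑ p ∈ primeWindow η y, a j p * conj (a j p))
        = ((q * ∑ p ∈ primeWindow η y, ‖a j p‖ ^ 2 : ℝ) : ℂ) := by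
      simp only [Complex.real_smul, Complex.mul_conj, Complex.normSq_eq_norm_sq]
      push_cast
      rfl
    rw [h1, ← Complex.ofReal_sub, Complex.norm_real, Real.norm_eq_abs] at h
    have h2 := (le_abs_self _).trans h.le
    have h3 : ε ≤ c i * η := by
      rw [hε]
      have h4 : (1 : ℝ) ≤ 2 * m ^ 2 := by
        have : (1 : ℝ) ≤ m := by exact_mod_cast hm
        nlinarith
      exact div_le_self (by have := hc i; positivity) h4
    have h5 : c i * η ≤ c i' * η := by gcongr; exact hi' i
    have h6 : c j * η ≤ c i' * η := by gcongr; exact hi' j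
    linarith

theorem norm_sum_mul_sq_le {m : ℕ} (x v : Fin m → ℂ) {r : ℝ} (hv : ∀ j, ‖v j‖ ≤ r) :
    ‖∑ j, x j * v j‖ ^ 2 ≤ m * r ^ 2 * ∑ j, ‖x j‖ ^ 2 := by
  calc ‖∑ j, x j * v j‖ ^ 2 ≤ (∑ j, ‖x j‖ * r) ^ 2 := by
        gcongr
        refine norm_sum_le_of_le _ fun j _ => ?_
        rw [norm_mul]
        gcongr
        exact hv j
    _ ≤ m * ∑ j, (‖x j‖ * r) ^ 2 := by
        simpa using sq_sum_le_card_mul_sum_sq (s := Finset.univ) (f := fun j => ‖x j‖ * r)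
    _ = m * r ^ 2 * ∑ j, ‖x j‖ ^ 2 := by
        rw [mul_assoc]
        simp only [mul_pow, Finset.mul_sum]
        congr 1
        ext j
        ring

theorem norm_sq_le_two_mul_add {E : Type*} [SeminormedAddCommGroup E] (x y : E) :
    ‖x‖ ^ 2 ≤ 2 * ‖y‖ ^ 2 + 2 * ‖y - x‖ ^ 2 := by
  have h : ‖x‖ ≤ ‖y‖ + ‖y - x‖ := by
    have := norm_sub_norm_le x y
    rw [norm_sub_rev] at this
    linarith
  nlinarith [norm_nonneg x, sq_nonneg (‖y‖ - ‖y - x‖)]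

theorem exists_norm_le_rpow_of_ramanujan {m : ℕ} {a : Fin m → ℕ → ℂ}
    (ha : ∀ j, ∀ ε : ℝ, 0 < ε → a j =O[atTop] fun n : ℕ => (n : ℝ) ^ ε) {ε : ℝ} (hε : 0 < ε) :
    ∃ C : ℝ, 0 < C ∧ ∀ᶠ n : ℕ in atTop, ∀ j, ‖a j n‖ ≤ C * (n : ℝ) ^ ε := by
  choose C hC hCO using fun j => (ha j ε hε).exists_pos
  refine ⟨1 + ∑ j, C j, ?_, eventually_all.2 fun j => ?_⟩
  · have := Finset.sum_nonneg fun j (_ : j ∈ Finset.univ) => (hC j).le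
    linarith
  · filter_upwards [(hCO j).bound] with n hn
    rw [Real.norm_of_nonneg (by positivity)] at hn
    refine hn.trans ?_
    gcongr
    have := Finset.single_le_sum (fun j _ => (hC j).le) (Finset.mem_univ j)
    linarith

/-- The arithmetic half of the argument: a family of entire functions of exponential type, one of
which exceeds `e^{-bx}`, `b < 1`, at arbitrarily large `x`, has a divergent sum over the primes. -/
theorem not_summable_of_large {m : ℕ} (hm : 1 ≤ m) {a : Fin m → ℕ → ℂ}
    (ha : ∀ j, ∀ ε : ℝ, 0 < ε → a j =O[atTop] fun n : ℕ => (n : ℝ) ^ ε)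
    (hSA : ∀ k, SelbergDiagonal m (a k))
    (hSB : ∀ k l, k ≠ l → SelbergOrthogonal m (a k) (a l))
    {Δ : Fin m → ℂ → ℂ} (hΔ : ∀ j, Differentiable ℂ (Δ j)) {A C b : ℝ} (hA : 0 ≤ A) (hC : 0 ≤ C)
    (hb : 0 ≤ b) (hb1 : b < 1) (hgrowth : ∀ j z, ‖Δ j z‖ ≤ C * Real.exp (A * ‖z‖)) (j₀ : Fin m)
    (hlarge : ∀ Y : ℝ, ∃ x : ℝ, Y ≤ x ∧ Real.exp (-(b * x)) < ‖Δ j₀ x‖) :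
    ¬ Summable fun p : Nat.Primes => ‖∑ j, a j p * Δ j (Real.log (p : ℕ) : ℂ)‖ := by
  intro hsum
  set T : ℝ := ∑' p : Nat.Primes, ‖∑ j, a j p * Δ j (Real.log (p : ℕ) : ℂ)‖ with hT
  have hT0 : 0 ≤ T := tsum_nonneg fun _ => norm_nonneg _
  set N : ℝ → ℝ := fun x => ‖fun j => Δ j x‖ with hN
  have hNc : Continuous N := by
    refine (continuous_pi fun j => ?_).norm
    exact (hΔ j).continuous.comp Complex.continuous_ofReal
  have hΔN : ∀ j (x : ℝ), ‖Δ j x‖ ≤ N x := fun j x => norm_le_pi_norm (fun j => Δ j (x : ℂ)) j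
  have hNgrowth : ∀ x : ℝ, 0 ≤ x → N x ≤ C * Real.exp (A * x) := by
    intro x hx
    refine (pi_norm_le_iff_of_nonneg (by positivity)).2 fun j => ?_
    have := hgrowth j x
    rwa [Complex.norm_real, Real.norm_of_nonneg hx] at this
  have hNlarge : ∀ Y : ℝ, ∃ x, Y ≤ x ∧ Real.exp (-(b * x)) < N x := fun Y => by
    obtain ⟨x, hx, hx'⟩ := hlarge Y
    exact ⟨x, hx, hx'.trans_le (hΔN j₀ x)⟩
  obtain ⟨K, hK, hKvar⟩ := exists_norm_sub_le_of_regular_point hA hC hb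
    (by positivity : 0 ≤ b + A + 1)
  obtain ⟨c, B, hc, hB, hwin⟩ := exists_window_bounds hm hSA hSB
  -- `η` is small enough for the variation of `Δ` over a window to be negligible
  set η : ℝ := min (1 / 2) (c / (4 * (m ^ 2 * K ^ 2 * B))) with hη
  have hm0 : (0 : ℝ) < m := by exact_mod_cast hm
  have hη0 : 0 < η := lt_min (by norm_num) (by positivity)
  have hη1 : η ≤ 1 / 2 := min_le_left _ _
  have hηc : m ^ 2 * K ^ 2 * B * η ≤ c / 4 := by
    have : η ≤ c / (4 * (m ^ 2 * K ^ 2 * B)) := min_le_right _ _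
    rw [le_div_iff₀ (by positivity)] at this
    linarith
  set ε : ℝ := (1 - b) / 2 with hε
  have hε0 : 0 < ε := by rw [hε]; linarith
  obtain ⟨C₀, hC₀, hram⟩ := exists_norm_le_rpow_of_ramanujan ha hε0
  set P : ℝ := m * (C₀ * Real.exp ε * (1 + K)) with hP
  have hram' : ∀ᶠ y : ℝ in atTop, ∀ n : ℕ, Real.exp y < n → ∀ j, ‖a j n‖ ≤ C₀ * (n : ℝ) ^ ε := by
    obtain ⟨n₀, hn₀⟩ := eventually_atTop.1 hram
    filter_upwards [Real.tendsto_exp_atTop.eventually_ge_atTop (n₀ : ℝ)] with y hy n hn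
    exact hn₀ n (by exact_mod_cast (hy.trans_lt hn).le)
  -- the lower bound for the sum over a window tends to infinity with `y`
  have hinf : ∀ᶠ y : ℝ in atTop, P * T < c / 4 * η * (Real.exp (ε * y) / y ^ 2) := by
    have h := (tendsto_exp_mul_div_rpow_atTop 2 ε hε0).const_mul_atTop
      (by positivity : 0 < c / 4 * η)
    filter_upwards [h.eventually_gt_atTop (P * T)] with y hy
    simpa using hy
  obtain ⟨Y, hY⟩ := eventually_atTop.1 ((hwin η hη0).and (hram'.and hinf))
  obtain ⟨y, hyY, hNy, hreg⟩ := exists_regular_point hNc hA hC hb hNgrowth hNlarge (max Y 1)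
  have hy1 : 1 ≤ y := (le_max_right _ _).trans hyY
  have hy0 : 0 < y := by linarith
  obtain ⟨⟨hlow, hup⟩, hry, hPT⟩ := hY y ((le_max_left _ _).trans hyY)
  have hNpos : 0 < N y := (Real.exp_pos _).trans_le hNy
  set W := primeWindow η y with hW
  set q : ℝ := y ^ 2 * Real.exp (-y) with hq
  have hq0 : 0 < q := by positivity
  have hvar : ∀ p ∈ W, ∀ j, ‖Δ j (Real.log p : ℝ) - Δ j y‖ ≤ K * η * N y := by
    intro p hp j
    obtain ⟨h1, h2⟩ := log_mem_of_mem_primeWindow hp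
    have h3 : |Real.log p - y| ≤ η / y := by
      rw [abs_of_pos (by linarith)]; linarith
    have h4 : η / y ≤ 1 / (2 * y) := by
      rw [div_le_div_iff₀ hy0 (by positivity)]; nlinarith
    refine (hKvar (Δ j) (hΔ j) (hgrowth j) y (N y) hy1 hNy
      (fun x hx => (hΔN j x).trans (hreg x hx)) _ (h3.trans h4)).trans ?_
    calc K * y * N y * |Real.log p - y| ≤ K * y * N y * (η / y) := by gcongr
      _ = K * η * N y := by field_simp
  set F : ℕ → ℂ := fun p => ∑ j, a j p * Δ j (Real.log p : ℝ) with hF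
  have hsq : c / 4 * η * N y ^ 2 ≤ q * ∑ p ∈ W, ‖F p‖ ^ 2 := by
    have h1 := hlow (fun j => Δ j y)
    have h2 : q * ∑ p ∈ W, ‖∑ j, a j p * Δ j y‖ ^ 2
        ≤ 2 * (q * ∑ p ∈ W, ‖F p‖ ^ 2)
          + 2 * (m * (K * η * N y) ^ 2 * ∑ j, q * ∑ p ∈ W, ‖a j p‖ ^ 2) := by
      have h3 : ∀ p ∈ W, ‖∑ j, a j p * Δ j y‖ ^ 2
          ≤ 2 * ‖F p‖ ^ 2 + 2 * (m * (K * η * N y) ^ 2 * ∑ j, ‖a j p‖ ^ 2) := by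
        intro p hp
        refine (norm_sq_le_two_mul_add _ (F p)).trans ?_
        gcongr
        rw [hF]
        simp only [← Finset.sum_sub_distrib, ← mul_sub]
        exact norm_sum_mul_sq_le (fun j => a j p) _ (hvar p hp)
      calc q * ∑ p ∈ W, ‖∑ j, a j p * Δ j y‖ ^ 2
          ≤ q * ∑ p ∈ W, (2 * ‖F p‖ ^ 2 + 2 * (m * (K * η * N y) ^ 2 * ∑ j, ‖a j p‖ ^ 2)) := by
            gcongr with p hp
            exact h3 p hp
        _ = _ := by
            rw [← Finset.mul_sum Finset.univ, Finset.sum_comm (s := Finset.univ),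
              Finset.sum_add_distrib, ← Finset.mul_sum, ← Finset.mul_sum, ← Finset.mul_sum]
            ring
    have h4 : ∑ j, q * ∑ p ∈ W, ‖a j p‖ ^ 2 ≤ m * (B * η) := by
      refine (Finset.sum_le_sum fun j _ => hup j).trans (le_of_eq ?_)
      simp
    have h5 : m * (K * η * N y) ^ 2 * ∑ j, q * ∑ p ∈ W, ‖a j p‖ ^ 2
        ≤ c / 4 * η * N y ^ 2 := by
      calc m * (K * η * N y) ^ 2 * ∑ j, q * ∑ p ∈ W, ‖a j p‖ ^ 2
          ≤ m * (K * η * N y) ^ 2 * (m * (B * η)) := by gcongr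
        _ = m ^ 2 * K ^ 2 * B * η * (η * η * N y ^ 2) := by ring
        _ ≤ c / 4 * (1 * η * N y ^ 2) := by
            gcongr
            linarith
        _ = c / 4 * η * N y ^ 2 := by ring
    have h6 : c * η * N y ^ 2 ≤ q * ∑ p ∈ W, ‖∑ j, a j p * Δ j y‖ ^ 2 := h1
    linarith
  have hsup : ∀ p ∈ W, ‖F p‖ ≤ P * Real.exp (ε * y) * N y := by
    intro p hp
    have hp0 : (0 : ℝ) < p := (Real.exp_pos y).trans (exp_lt_of_mem_primeWindow hp)
    have hpe : (p : ℝ) ^ ε ≤ Real.exp ε * Real.exp (ε * y) := by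
      rw [Real.rpow_def_of_pos hp0, ← Real.exp_add]
      apply Real.exp_le_exp.2
      have h1 := (log_mem_of_mem_primeWindow hp).2
      have h2 : η / y ≤ 1 := by rw [div_le_one hy0]; linarith
      nlinarith
    have hj : ∀ j, ‖a j p * Δ j (Real.log p : ℝ)‖
        ≤ C₀ * (Real.exp ε * Real.exp (ε * y)) * ((1 + K) * N y) := by
      intro j
      have h1 : ‖Δ j (Real.log p : ℝ)‖ ≤ (1 + K) * N y := by
        have h2 := norm_le_norm_add_norm_sub' (Δ j (Real.log p : ℝ)) (Δ j y)
        have h3 := hvar p hp j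
        have h4 : K * η * N y ≤ K * 1 * N y := by gcongr; linarith
        linarith [hΔN j y]
      rw [norm_mul]
      gcongr
      exact (hry p (exp_lt_of_mem_primeWindow hp) j).trans (by gcongr)
    calc ‖F p‖ ≤ ∑ _j : Fin m, C₀ * (Real.exp ε * Real.exp (ε * y)) * ((1 + K) * N y) :=
          norm_sum_le_of_le _ fun j _ => hj j
      _ = P * Real.exp (ε * y) * N y := by
          simp only [Finset.sum_const, Finset.card_univ, Fintype.card_fin, nsmul_eq_mul, hP]
          ring
  have hsumW : ∑ p ∈ W, ‖F p‖ ≤ T := by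
    have h := Finset.sum_subtype_of_mem (s := W) (p := Nat.Prime) (fun p => ‖F p‖)
      (fun p hp => prime_of_mem_primeWindow hp)
    rw [← h]
    have hle : ∀ {ι : Type} (f : ι → ℝ), Summable f → (∀ i, 0 ≤ f i) →
        ∀ s : Finset ι, ∑ i ∈ s, f i ≤ ∑' i, f i := fun f hf hf0 s =>
      hf.sum_le_tsum s fun i _ => hf0 i
    exact hle _ hsum (fun _ => norm_nonneg _) (W.subtype Nat.Prime)
  have hP0 : 0 ≤ P := by positivity
  have hfin : c / 4 * η * N y ^ 2 ≤ q * (P * Real.exp (ε * y) * N y * T) := by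
    refine hsq.trans ?_
    gcongr
    calc ∑ p ∈ W, ‖F p‖ ^ 2 ≤ ∑ p ∈ W, P * Real.exp (ε * y) * N y * ‖F p‖ := by
          gcongr with p hp
          rw [sq]
          gcongr
          exact hsup p hp
      _ = P * Real.exp (ε * y) * N y * ∑ p ∈ W, ‖F p‖ := (Finset.mul_sum _ _ _).symm
      _ ≤ P * Real.exp (ε * y) * N y * T := by gcongr
  have hfin' : c / 4 * η * N y ≤ q * (P * Real.exp (ε * y) * T) := by
    refine le_of_mul_le_mul_right ?_ hNpos
    linarith
  have hfin'' : c / 4 * η * Real.exp (-(b * y)) ≤ q * (P * Real.exp (ε * y) * T) :=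
    le_trans (by gcongr) hfin'
  have hcontra : c / 4 * η * (Real.exp (ε * y) / y ^ 2) ≤ P * T := by
    have h1 : c / 4 * η * (Real.exp (ε * y) / y ^ 2)
        = c / 4 * η * Real.exp (-(b * y)) * (Real.exp y / (Real.exp (ε * y) * y ^ 2)) := by
      have h2 : Real.exp (ε * y) * Real.exp (ε * y) = Real.exp (-(b * y)) * Real.exp y := by
        rw [← Real.exp_add, ← Real.exp_add]
        congr 1
        rw [hε]; ring
      field_simp
      rw [sq, h2, mul_comm y b]
    have h3 : q * (P * Real.exp (ε * y) * T) * (Real.exp y / (Real.exp (ε * y) * y ^ 2))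
        = P * T := by
      rw [hq, Real.exp_neg]
      field_simp
    rw [h1, ← h3]
    gcongr
  exact absurd hPT (not_lt.2 hcontra)

theorem mainTheorem3 (m : ℕ) (L : Fin m → ℂ → ℂ) (a : Fin m → ℕ → ℂ)
    (hL : ∀ j, IsSelbergClass (L j) (a j))
    (hSA : ∀ k, SelbergDiagonal m (a k))
    (hSB : ∀ k l, k ≠ l → SelbergOrthogonal m (a k) (a l))
    (σ₁ σ₂ : ℝ) (hσ : σ₁ < σ₂) (hσ₂ : σ₂ < 1)
    (U : Set ℂ) (hU : IsOpen U) (hUb : Bornology.IsBounded U)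
    (hUD : closure U ⊆ verticalStrip σ₁ σ₂)
    (g : Fin m → bergmanSpace (verticalStrip σ₁ σ₂) U) (hg : g ≠ 0) :
    ¬ Summable fun p : Nat.Primes =>
      ‖∑ j, a j p * bergmanTransform (g j : Lp ℂ 2 (volume.restrict U))
        (Real.log (p : ℕ) : ℂ)‖ := by
  obtain ⟨j₀, hj₀⟩ := Function.ne_iff.1 hg
  have hm : 1 ≤ m := j₀.pos
  obtain ⟨A, hA, hgrowth⟩ := exists_norm_bergmanTransform_le hU hUb
  choose C hC hCg using fun j => hgrowth (g j : Lp ℂ 2 (volume.restrict U))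
  refine not_summable_of_large hm (fun j => (hL j).ramanujan) hSA hSB
    (fun j => differentiable_bergmanTransform hU hUb _) (C := ∑ j, C j) hA
    (Finset.sum_nonneg fun j _ => hC j)
    (le_max_right σ₂ 0) (max_lt hσ₂ one_pos) (fun j z => (hCg j z).trans ?_) j₀
    (exists_lt_norm_bergmanTransform hσ hU hUb hUD hj₀ (le_max_left σ₂ 0))
  gcongr
  exact Finset.single_le_sum (fun j _ => hC j) (Finset.mem_univ j)
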